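/- For a small category $C$ let $\mathcal F C$ be the free category on $C$: it has the objects of $C$, its morphisms are the words of composable non-identity morphisms of $C$, composition is concatenation and identities are empty words. $\mathcal F$ is a comonad on small categories, with counit $U_C\colon \mathcal F C\to C$ composing words and comultiplication $\Delta_C\colon\mathcal F C\to\mathcal F^2C$, $(f)\mapsto((f))$. The free simplicial resolution $\mathcal F_\bullet C$ is the simplicial category with $\mathcal F_qC=\mathcal F^{q+1}C$, $d_i=\mathcal F^i(U)$ and $s_i=\mathcal F^i(\Delta)$, with the same objects as $C$ in each degree. The double bar construction $B(\ast,\mathcal F_\bullet C,\ast)$ is the bisimplicial set $$B(\ast,\mathcal F_\bullet C,\ast)_{p,q}=\coprod_{\alpha_0,\dots,\alpha_p\in \mathrm{Ob}\,C}\mathcal F_qC(\alpha_{p-1},\alpha_p)\times\cdots\times\mathcal F_qC(\alpha_0,\alpha_1),$$ where the structure maps in the direction $p$ are given by composition, by dropping the end morphisms and by inserting identities (as in the nerve). Its realization is the quotient space $$|B(\ast,\mathcal F_\bullet C,\ast)|=\Big(\coprod_{p,q}B(\ast,\mathcal F_\bullet C,\ast)_{p,q}\times|\Delta^p|\times|\Delta^q|\Big)\Big/\sim$$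 by the usual identifications in both simplicial directions. It is a functor of $C$. Write $\mathcal F_\bullet[n]$ for $\mathcal F_\bullet C$ with $C=[n]=\{0<\dots<n\}$. Let $\widetilde\Delta$ be the subcategory of the simplex category $\Delta$ which has the same objects and whose morphisms are generated by the injections $[k]\hookrightarrow[m]$ and the surjection $[1]\to[0]$. **Theorem.** There is a natural homeomorphism $h\colon|B(\ast,\mathcal F_\bullet,\ast)|\to\Delta^\bullet$ of functors $\widetilde\Delta\to\mathbf{Top}$, that is, an isomorphism between the functors $[n]\mapsto|B(\ast,\mathcal F_\bullet[n],\ast)|$ and $[n]\mapsto|\Delta^n|$ restricted to $\widetilde\Delta$. Moreover $h$ can be chosen so that it is given by the following explicit formula. For $x\in B(\ast,\mathcal F_\bullet[n],\ast)_{p,q}$ over $\alpha_0\le\dots\le\alpha_p$, $\tau\in|\Delta^p|$, $\sigma\in|\Delta^q|$ and $u\in\{0,\dots,n\}$ put $$t_u=\sum_{k:\ \alpha_k=u}\tau_k,\qquad s_u=\sum_{l:\ u\in V_l(x)}\sigma_l,$$ where $V_l(x)$ is the set of objects through which the $l$-th vertex (a morphism of $\mathcal F_0[n]=\mathcal F[n]$)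 of the composite $\alpha_0\to\alpha_p$ of $x$ factors. (Thus $t$ are barycentric coordinates, and $s_u$ are the coordinates in the cube $|\mathcal F_\bullet[n](\alpha_0,\alpha_p)|\cong[0,1]^{\alpha_p-\alpha_0-1}$ for $\alpha_0<u<\alpha_p$.) Then $$h_n([x,\tau,\sigma])=\frac{1}{\sum_{v=0}^na_v}(a_0,\dots,a_n),\qquad a_u=t_u+s_u\cdot\max_{v<u<w}\min(t_v,t_w),$$ where the maximum over the empty set is $0$. -/

import Mathlib

open CategoryTheory Opposite

noncomputable section

namespace FreeBar

/-! ### The free simplicial resolution of a small category -/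

/-- The free category comonad `F` on small categories. A morphism of `F C` is a word of composable
non-identity morphisms of `C`: it is a path in `C`, where identity arrows are identified with empty
paths. The counit `F C ⟶ C` composes a word, the comultiplication `F C ⟶ F (F C)` sends
a one-letter word `(f)` to `((f))`. -/
abbrev freeCat : Comonad Cat.{0, 0} := ReflQuiv.adj.{0, 0}.toComonad

/-- The `k`-fold iterate `F ^ k`. The last applied copy of `F` is the outermost one. -/
def freePow : ℕ → (Cat.{0, 0} ⥤ Cat.{0, 0})
  | 0 => 𝟭 _
  | k + 1 => freePow k ⋙ freeCat.toFunctor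

/-- `F ^ i (U_{F ^ (k - i) C}) : F ^ (k + 1) C ⟶ F ^ k C`, for the counit `U`. -/
def counitAt : (k : ℕ) → Fin (k + 1) → (freePow (k + 1) ⟶ freePow k)
  | k, ⟨0, _⟩ => (freePow k).whiskerLeft freeCat.ε
  | k + 1, ⟨i + 1, hi⟩ =>
      Functor.whiskerRight (counitAt k ⟨i, Nat.lt_of_succ_lt_succ hi⟩) freeCat.toFunctor

/-- `F ^ i (Δ_{F ^ (k - i) C}) : F ^ (k + 1) C ⟶ F ^ (k + 2) C`, for the comultiplication `Δ`. -/
def comultAt : (k : ℕ) → Fin (k + 1) → (freePow (k + 1) ⟶ freePow (k + 2))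
  | k, ⟨0, _⟩ => (freePow k).whiskerLeft freeCat.δ
  | k + 1, ⟨i + 1, hi⟩ =>
      Functor.whiskerRight (comultAt k ⟨i, Nat.lt_of_succ_lt_succ hi⟩) freeCat.toFunctor

/-- The category `F_q C = F ^ (q + 1) C` of `q`-simplices of the simplicial category `F_• C`. All
the categories `F_q C` have the same objects as `C`. -/
abbrev res (q : ℕ) : Cat.{0, 0} ⥤ Cat.{0, 0} := freePow (q + 1)

/-- The face maps `d_i : F_{q + 1} C ⟶ F_q C`. -/
abbrev resFace (q : ℕ) (i : Fin (q + 2)) : res (q + 1) ⟶ res q := counitAt (q + 1) i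

/-- The degeneracy maps `s_i : F_q C ⟶ F_{q + 1} C`. -/
abbrev resDegen (q : ℕ) (i : Fin (q + 1)) : res q ⟶ res (q + 1) := comultAt q i

/-! ### The double bar construction and its realization -/

/-- For a simplicial category `𝓒` with a fixed set of objects, the bar construction `B(*, 𝓒, *)` is
the bisimplicial set whose set of `(p, q)`-simplices is the disjoint union, over all objects
`α_0, …, α_p`, of `𝓒(α_{p-1}, α_p)_q × ⋯ × 𝓒(α_0, α_1)_q`, that is, the set of `p`-simplices of the
nerve of the category of `q`-simplices of `𝓒`. This is the simplicial set `B(*, F_• C, *)_{•, q}`. -/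
abbrev bar (q : ℕ) : Cat.{0, 0} ⥤ SSet.{0} := res q ⋙ nerveFunctor

/-- The set `B(*, F_• C, *)_{p, q}`. -/
abbrev BarSimplex (C : Cat.{0, 0}) (p q : ℕ) : Type :=
  ((bar q).obj C).obj (op (SimplexCategory.mk p))

/-- The map `B(*, F_• C, *)_{p, q + 1} → B(*, F_• C, *)_{p, q}` induced by `d_i`. -/
def barFace {C : Cat.{0, 0}} {p q : ℕ} (i : Fin (q + 2)) (x : BarSimplex C p (q + 1)) :
    BarSimplex C p q :=
  (nerveFunctor.map ((resFace q i).app C)).app (op (SimplexCategory.mk p)) x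

/-- The map `B(*, F_• C, *)_{p, q} → B(*, F_• C, *)_{p, q + 1}` induced by `s_i`. -/
def barDegen {C : Cat.{0, 0}} {p q : ℕ} (i : Fin (q + 1)) (x : BarSimplex C p q) :
    BarSimplex C p (q + 1) :=
  (nerveFunctor.map ((resDegen q i).app C)).app (op (SimplexCategory.mk p)) x

/-- The topological space `∐_{p, q} B(*, F_• C, *)_{p, q} × |Δ^p| × |Δ^q|`. -/
abbrev BarCells (C : Cat.{0, 0}) : Type :=
  Σ x : (Σ p q : ℕ, BarSimplex C p q),
    stdSimplex ℝ (Fin (x.1 + 1)) × stdSimplex ℝ (Fin (x.2.1 + 1))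

/-- The point of `BarCells C` given by `x`, `τ` and `σ`. -/
def cell {C : Cat.{0, 0}} {p q : ℕ} (x : BarSimplex C p q) (τ : stdSimplex ℝ (Fin (p + 1)))
    (σ : stdSimplex ℝ (Fin (q + 1))) : BarCells C :=
  ⟨⟨p, q, x⟩, (τ, σ)⟩

/-- The identifications which define the realization of the bisimplicial set `B(*, F_• C, *)`, in the
bar direction (for all simplicial operators) and in the direction of the resolution
(for the face and the degeneracy maps, which generate the simplicial operators). -/
inductive BarRel (C : Cat.{0, 0}) : BarCells C → BarCells C → Prop
  | bar {p p' q : ℕ} (θ : SimplexCategory.mk p' ⟶ SimplexCategory.mk p) (x : BarSimplex C p q)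
      (τ : stdSimplex ℝ (Fin (p' + 1))) (σ : stdSimplex ℝ (Fin (q + 1))) :
      BarRel C (cell (((bar q).obj C).map θ.op x) τ σ) (cell x (stdSimplex.map θ τ) σ)
  | face {p q : ℕ} (i : Fin (q + 2)) (x : BarSimplex C p (q + 1)) (τ : stdSimplex ℝ (Fin (p + 1)))
      (σ : stdSimplex ℝ (Fin (q + 1))) :
      BarRel C (cell (barFace i x) τ σ) (cell x τ (stdSimplex.map (SimplexCategory.δ i) σ))
  | degen {p q : ℕ} (i : Fin (q + 1)) (x : BarSimplex C p q) (τ : stdSimplex ℝ (Fin (p + 1)))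
      (σ : stdSimplex ℝ (Fin (q + 2))) :
      BarRel C (cell (barDegen i x) τ σ) (cell x τ (stdSimplex.map (SimplexCategory.σ i) σ))

/-- The geometric realization `|B(*, F_• C, *)|`, with the quotient topology. -/
abbrev BarSpace (C : Cat.{0, 0}) : Type := Quot (BarRel C)

/-- The map induced by a functor `C ⥤ D` on cells. -/
def cellMap {C D : Cat.{0, 0}} (f : C ⟶ D) (z : BarCells C) : BarCells D :=
  cell (((bar z.1.2.1).map f).app (op (SimplexCategory.mk z.1.1)) z.1.2.2) z.2.1 z.2.2

lemma continuous_cellMap {C D : Cat.{0, 0}} (f : C ⟶ D) : Continuous (cellMap f) := by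
  refine continuous_sigma fun x => ?_
  exact continuous_sigmaMk (σ := fun x : (Σ p q : ℕ, BarSimplex D p q) =>
    stdSimplex ℝ (Fin (x.1 + 1)) × stdSimplex ℝ (Fin (x.2.1 + 1)))
    (i := ⟨x.1, x.2.1, ((bar x.2.1).map f).app (op (SimplexCategory.mk x.1)) x.2.2⟩)

lemma cellMap_rel {C D : Cat.{0, 0}} (f : C ⟶ D) (y z : BarCells C) (h : BarRel C y z) :
    BarRel D (cellMap f y) (cellMap f z) := by
  cases h with
  | bar θ x τ σ =>
    have e : ((bar _).map f).app (op _) (((bar _).obj C).map θ.op x) =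
        ((bar _).obj D).map θ.op (((bar _).map f).app (op _) x) :=
      ConcreteCategory.congr_hom (((bar _).map f).naturality θ.op) x
    have r := BarRel.bar θ (((bar _).map f).app (op _) x) τ σ
    rw [← e] at r
    exact r
  | face i x τ σ =>
    have e : ((bar _).map f).app (op _) (barFace i x) =
        barFace i (((bar _).map f).app (op _) x) :=
      (ConcreteCategory.congr_hom (NatTrans.congr_app
        ((Functor.whiskerRight (resFace _ i) nerveFunctor).naturality f) (op _)) x).symm
    have r := BarRel.face i (((bar _).map f).app (op _) x) τ σ
    rw [← e] at r
    exact r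
  | degen i x τ σ =>
    have e : ((bar _).map f).app (op _) (barDegen i x) =
        barDegen i (((bar _).map f).app (op _) x) :=
      (ConcreteCategory.congr_hom (NatTrans.congr_app
        ((Functor.whiskerRight (resDegen _ i) nerveFunctor).naturality f) (op _)) x).symm
    have r := BarRel.degen i (((bar _).map f).app (op _) x) τ σ
    rw [← e] at r
    exact r

lemma cellMap_id (C : Cat.{0, 0}) (z : BarCells C) : cellMap (𝟙 C) z = z := by
  obtain ⟨⟨p, q, x⟩, τ, σ⟩ := z
  simp only [cellMap, CategoryTheory.Functor.map_id]
  rfl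

lemma cellMap_comp {C D E : Cat.{0, 0}} (f : C ⟶ D) (g : D ⟶ E) (z : BarCells C) :
    cellMap (f ≫ g) z = cellMap g (cellMap f z) := by
  obtain ⟨⟨p, q, x⟩, τ, σ⟩ := z
  simp only [cellMap, Functor.map_comp]
  rfl

/-- The functor `C ↦ |B(*, F_• C, *)|`. -/
def barRealization : Cat.{0, 0} ⥤ TopCat.{0} where
  obj C := TopCat.of (BarSpace C)
  map f := TopCat.ofHom ⟨Quot.map (cellMap f) (cellMap_rel f),
    continuous_quot_lift _ (continuous_quot_mk.comp (continuous_cellMap f))⟩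
  map_id C := by
    ext z
    induction z using Quot.ind with
    | mk z => exact congrArg (Quot.mk _) (cellMap_id C z)
  map_comp f g := by
    ext z
    induction z using Quot.ind with
    | mk z => exact congrArg (Quot.mk _) (cellMap_comp f g z)

/-! ### Coordinates -/

/-- The composition of all words, `F ^ k C ⟶ C`. It is the identity on objects. -/
def augment : (k : ℕ) → (freePow k ⟶ 𝟭 Cat.{0, 0})
  | 0 => 𝟙 _
  | k + 1 => counitAt k 0 ≫ augment k

/-- The map `F_q C ⟶ F_0 C` which sends each morphism, viewed as a `q`-simplex, to its `l`-th
vertex. -/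
def vertex : (q : ℕ) → Fin (q + 1) → (res q ⟶ res 0)
  | q, ⟨0, _⟩ => Functor.whiskerRight (augment q) freeCat.toFunctor
  | q + 1, ⟨l + 1, hl⟩ => resFace q 0 ≫ vertex q ⟨l, Nat.lt_of_succ_lt_succ hl⟩

/-- The object of `C` which underlies an object of `F_q C`. -/
def label {C : Cat.{0, 0}} {q : ℕ} (X : (res q).obj C) : C :=
  ((augment (q + 1)).app C).toFunctor.obj X

/-- The `l`-th vertex of the composite `α_0 → α_p` of the string `x`, which is a word in `F C`,
passes through the object `u`. -/
def Passes {C : Cat.{0, 0}} {p q : ℕ} (x : ComposableArrows ((res q).obj C) p) (l : Fin (q + 1))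
    (u : C) : Prop :=
  ∃ (Z : (res 0).obj C) (f : ((vertex q l).app C).toFunctor.obj x.left ⟶ Z)
    (g : Z ⟶ ((vertex q l).app C).toFunctor.obj x.right),
    label Z = u ∧ f ≫ g = ((vertex q l).app C).toFunctor.map x.hom

open Classical in
/-- The coordinate `t_u`: the sum of the barycentric coordinates `τ_k` with `α_k = u`. -/
def objWeight {C : Cat.{0, 0}} {p q : ℕ} (x : ComposableArrows ((res q).obj C) p)
    (τ : stdSimplex ℝ (Fin (p + 1))) (u : C) : ℝ :=
  ∑ k, if label (x.obj k) = u then τ k else 0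

open Classical in
/-- The cubical coordinate `s_u`: the sum of the barycentric coordinates `σ_l` for which
the `l`-th vertex passes through `u`. -/
def passWeight {C : Cat.{0, 0}} {p q : ℕ} (x : ComposableArrows ((res q).obj C) p)
    (σ : stdSimplex ℝ (Fin (q + 1))) (u : C) : ℝ :=
  ∑ l, if Passes x l u then σ l else 0

/-- The number `a_u = t_u + s_u * max_{v < u < w} min (t_v, t_w)`, where the maximum over the empty
set is zero. -/
def unnormalized {n p q : ℕ}
    (x : BarSimplex (SimplexCategory.toCat.obj (SimplexCategory.mk n)) p q)
    (τ : stdSimplex ℝ (Fin (p + 1))) (σ : stdSimplex ℝ (Fin (q + 1))) (u : Fin (n + 1)) : ℝ :=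
  objWeight x τ u + passWeight x σ u *
    ⨆ vw : {vw : Fin (n + 1) × Fin (n + 1) // vw.1 < u ∧ u < vw.2},
      min (objWeight x τ vw.1.1) (objWeight x τ vw.1.2)

/-- The `u`-th barycentric coordinate of a point of `|Δ^n|`. -/
def coord {n : ℕ} (y : SimplexCategory.toTop₀.obj (SimplexCategory.mk n)) (u : Fin (n + 1)) : ℝ :=
  (y : stdSimplex ℝ (Fin (n + 1))).1 u

/-! ### The indexing category -/

/-- The injections of `Δ` and the surjection `[1] → [0]`. -/
inductive tildeGen : MorphismProperty SimplexCategory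
  | inj {k m : SimplexCategory} (f : k ⟶ m) (hf : Function.Injective f) : tildeGen f
  | collapse : tildeGen (SimplexCategory.σ (0 : Fin 1))

/-- The subcategory of `Δ` with the same objects and with morphisms generated by the injections
and the surjection `[1] → [0]`. -/
abbrev DeltaTilde : Type := WideSubcategory tildeGen.multiplicativeClosure

/-- The inclusion of `DeltaTilde` into `Δ`. -/
abbrev tildeIncl : DeltaTilde ⥤ SimplexCategory :=
  wideSubcategoryInclusion tildeGen.multiplicativeClosure

end FreeBar

end

noncomputable section

namespace FreeBar

/-! ### Vertex sets of words -/

/-! A `q`-simplex of morphisms in the resolution of `[n]` is a nested bracketing of a word. It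
amounts to a chain `V_0 ⊆ … ⊆ V_q` of subsets of the interval between source and target, each
containing both ends, where `V_l` is the set of objects visited by the `l`-th vertex. So a bisimplex
of the bar construction is a weakly increasing sequence `α` with such a chain for which all `α_k`
lie in `V_0`: these data determine the bisimplex (`string_ext`), and all of them occur
(`exists_string`).

Simplicial operators reindex `α` and `V`; those in the bar direction also cut the `V_l` down to the
new interval. The cut changes `s` only at objects where the maximum in the formula vanishes, so the
formula descends to the quotient (`cellPoint_rel`).

Each point has a representative with `α` and `V` strictly increasing and all weights positive
(`exists_isReduced`). It is recovered from `(t, s)`: `α` and `τ` are the support and the values of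
`t`, while `V` and `σ` form the layer decomposition of `s` (`finset_chain_mass`,
`exists_level_chain`). The pairs that occur are those with `IsCoord` and `∑ t = 1`.

It remains to recover `(t, s)` from `a`. Under `IsCoord`, `t` solves `t_u = max 0 (a_u - gap t u)`,
an equation with exactly one solution for every `a ≥ 0` (`IsGapSolution.unique`,
`exists_gapSolution`), and `s` is then read off. All is homogeneous in `t`, so normalization loses
nothing. The comparison map is thus a continuous bijection from a compact space, covered by finitely
many cells, to a Hausdorff space.

For naturality, an injection extends all coordinates by zero, and the collapse `[1] → [0]` has a
point as target. -/

/-- The category with objects the elements of `P` whose morphisms from `a` to `b` are the finite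
sets of elements between `a` and `b` that contain `a` and `b`. Composition is union. -/
structure SpanCat (P : Type) where
  /-- The underlying element. -/
  pt : P

section Words

variable {P : Type} [LinearOrder P]

instance : Category (SpanCat P) where
  Hom a b := {S : Finset P // a.pt ∈ S ∧ b.pt ∈ S ∧ ∀ u ∈ S, a.pt ≤ u ∧ u ≤ b.pt}
  id a := ⟨{a.pt}, by simp⟩
  comp {a b c} S T := ⟨S.1 ∪ T.1, by
    obtain ⟨S, hS1, hS2, hS3⟩ := S
    obtain ⟨T, hT1, hT2, hT3⟩ := T
    have h1 := (hS3 _ hS2).1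
    have h2 := (hT3 _ hT1).2
    refine ⟨by simp [hS1], by simp [hT2], fun u hu => ?_⟩
    rcases Finset.mem_union.1 hu with hu | hu
    · exact ⟨(hS3 u hu).1, (hS3 u hu).2.trans h2⟩
    · exact ⟨h1.trans (hT3 u hu).1, (hT3 u hu).2⟩⟩
  id_comp S := Subtype.ext (by simpa using S.2.1)
  comp_id S := Subtype.ext (by simpa using S.2.2.1)
  assoc S T U := Subtype.ext (by simp [Finset.union_assoc])

/-- The morphism given by a set with at most two elements. -/
def SpanCat.edge {a b : P} (h : a ≤ b) : (⟨a⟩ : SpanCat P) ⟶ ⟨b⟩ :=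
  Subtype.mk (p := fun S : Finset P => a ∈ S ∧ b ∈ S ∧ ∀ u ∈ S, a ≤ u ∧ u ≤ b) {a, b}
    (by simp [h])

variable {C : Type} [Category.{0} C] (π : C ⥤ P)

/-- The functor sending a word to the set of the labels of its vertices. -/
def verts : Cat.FreeRefl C ⥤ SpanCat P :=
  Cat.FreeRefl.lift' (fun c => ⟨π.obj c⟩) (fun f => SpanCat.edge (leOfHom (π.map f)))
    (fun _ => Subtype.ext (Finset.pair_eq_singleton _))

/-- The set of the labels of the vertices of a word. -/
def passSet {X Y : Cat.FreeRefl C} (f : X ⟶ Y) : Finset P := ((verts π).map f).1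

/-- The functor composing words. -/
abbrev evalWord (C : Type) [Category.{0} C] : Cat.FreeRefl C ⥤ C := Cat.FreeRefl.lift (𝟭rq C)

/-- The label of an object of the free category. -/
abbrev wordLabel : Cat.FreeRefl C ⥤ P := evalWord C ⋙ π

@[simp] lemma wordLabel_mk (c : C) : (wordLabel π).obj (.mk c) = π.obj c := rfl

lemma passSet_id (X : Cat.FreeRefl C) : passSet π (𝟙 X) = {(wordLabel π).obj X} := by
  simp only [passSet, CategoryTheory.Functor.map_id]
  rfl

lemma passSet_comp {X Y Z : Cat.FreeRefl C} (f : X ⟶ Y) (g : Y ⟶ Z) :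
    passSet π (f ≫ g) = passSet π f ∪ passSet π g := by
  simp only [passSet, Functor.map_comp]
  rfl

lemma passSet_homMk {a b : C} (f : a ⟶ b) :
    passSet π (Cat.FreeRefl.homMk f) = {π.obj a, π.obj b} := by
  exact congrArg Subtype.val (Cat.FreeRefl.lift'_map (D := SpanCat P) (V := C) (fun c => ⟨π.obj c⟩)
    (fun f => SpanCat.edge (leOfHom (π.map f)))
    (fun c => Subtype.ext (Finset.pair_eq_singleton _)) f)

variable {π}

lemma source_mem_passSet {X Y : Cat.FreeRefl C} (f : X ⟶ Y) :
    (wordLabel π).obj X ∈ passSet π f := ((verts π).map f).2.1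

lemma target_mem_passSet {X Y : Cat.FreeRefl C} (f : X ⟶ Y) :
    (wordLabel π).obj Y ∈ passSet π f := ((verts π).map f).2.2.1

lemma le_of_mem_passSet {X Y : Cat.FreeRefl C} {f : X ⟶ Y} {u : P} (hu : u ∈ passSet π f) :
    (wordLabel π).obj X ≤ u ∧ u ≤ (wordLabel π).obj Y := ((verts π).map f).2.2.2 u hu

/-- Labels weakly increase along a word, so cutting at the label of `Y` separates the two factors,
with only that label on both sides. With `passSet_right`, the vertices of a factor can be read off
from the composite. -/
lemma passSet_left {X Y Z : Cat.FreeRefl C} (f : X ⟶ Y) (g : Y ⟶ Z) :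
    passSet π f = (passSet π (f ≫ g)).filter (· ≤ (wordLabel π).obj Y) := by
  ext u
  rw [passSet_comp, Finset.mem_filter, Finset.mem_union]
  constructor
  · exact fun h => ⟨.inl h, (le_of_mem_passSet h).2⟩
  · rintro ⟨h | h, hu⟩
    · exact h
    · rw [le_antisymm hu (le_of_mem_passSet h).1]
      exact target_mem_passSet f

lemma passSet_right {X Y Z : Cat.FreeRefl C} (f : X ⟶ Y) (g : Y ⟶ Z) :
    passSet π g = (passSet π (f ≫ g)).filter ((wordLabel π).obj Y ≤ ·) := by
  ext u
  rw [passSet_comp, Finset.mem_filter, Finset.mem_union]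
  constructor
  · exact fun h => ⟨.inr h, (le_of_mem_passSet h).1⟩
  · rintro ⟨h | h, hu⟩
    · rw [le_antisymm (le_of_mem_passSet h).2 hu]
      exact source_mem_passSet g
    · exact h

/-- A word passes through the labels of its vertices, and through no other label. -/
lemma mem_passSet_iff {X Y : Cat.FreeRefl C} (f : X ⟶ Y) (u : P) :
    u ∈ passSet π f ↔ ∃ (Z : Cat.FreeRefl C) (g : X ⟶ Z) (h : Z ⟶ Y),
      (wordLabel π).obj Z = u ∧ g ≫ h = f := by
  constructor
  · intro hu
    induction f using Cat.FreeRefl.hom_induction with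
    | id x =>
      refine ⟨.mk x, 𝟙 _, 𝟙 _, ?_, ?_⟩
      · rw [Cat.FreeRefl.homMk_id, passSet_id, Finset.mem_singleton] at hu
        exact hu.symm
      · rw [Cat.FreeRefl.homMk_id, Category.id_comp]
    | @comp_homMk x y z f g ih =>
      rw [passSet_comp, Finset.mem_union, passSet_homMk] at hu
      rcases hu with hu | hu
      · obtain ⟨Z, k, h, e, rfl⟩ := ih hu
        exact ⟨Z, k, h ≫ Cat.FreeRefl.homMk g, e, by rw [Category.assoc]⟩
      · rw [Finset.mem_insert, Finset.mem_singleton] at hu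
        rcases hu with rfl | rfl
        · exact ⟨.mk y, f, Cat.FreeRefl.homMk g, rfl, rfl⟩
        · exact ⟨.mk z, f ≫ Cat.FreeRefl.homMk g, 𝟙 _, rfl, Category.comp_id _⟩
  · rintro ⟨Z, g, h, rfl, rfl⟩
    rw [passSet_comp]
    exact Finset.mem_union_left _ (target_mem_passSet g)

/-- A letter that `F` sends to an identity disappears from the word, but its two ends then have
equal labels, so the set does not notice. -/
lemma passSet_freeReflMap {D : Type} [Category.{0} D] (F : D ⥤ C) {X Y : Cat.FreeRefl D}
    (f : X ⟶ Y) :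
    passSet π ((Cat.freeReflMap F.toReflPrefunctor).map f) = passSet (F ⋙ π) f := by
  induction f using Cat.FreeRefl.hom_induction with
  | id x =>
    rw [Cat.FreeRefl.homMk_id, CategoryTheory.Functor.map_id, passSet_id, passSet_id]
    rfl
  | comp_homMk f g ih =>
    rw [Functor.map_comp, passSet_comp, ih, passSet_comp, passSet_homMk]
    exact congrArg _ (passSet_homMk π (F.map g))

lemma passSet_map {Q : Type} [LinearOrder Q] (m : P ⥤ Q) {X Y : Cat.FreeRefl C} (f : X ⟶ Y) :
    passSet (π ⋙ m) f = (passSet π f).image m.obj := by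
  induction f using Cat.FreeRefl.hom_induction with
  | id x =>
    rw [Cat.FreeRefl.homMk_id, passSet_id, passSet_id]
    rfl
  | comp_homMk f g ih =>
    rw [passSet_comp, ih, passSet_comp, passSet_homMk, passSet_homMk, Finset.image_union]
    simp

/-! ### Rigidity and its inheritance by free categories -/

/-- Labelled categories in which a morphism has at most one factorization through objects with given
labels, and factorizations are ordered as their labels. -/
structure Rigid (π : C ⥤ P) : Prop where
  bij : Function.Bijective π.obj
  cancel {a b c : C} {f f' : a ⟶ b} {g g' : b ⟶ c} : f ≫ g = f' ≫ g' → f = f' ∧ g = g'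
  interp {a b c d : C} {f : a ⟶ c} {g : c ⟶ d} {f' : a ⟶ b} {g' : b ⟶ d} :
    f ≫ g = f' ≫ g' → π.obj b ≤ π.obj c → ∃ m : b ⟶ c, f' ≫ m = f ∧ m ≫ g = g'

namespace Rigid

lemma endo (h : Rigid π) {a : C} (f : a ⟶ a) : f = 𝟙 a :=
  (h.cancel (by simp : f ≫ 𝟙 a = 𝟙 a ≫ f)).1

lemma wordLabel_bijective (h : Rigid π) : Function.Bijective (wordLabel π).obj := by
  constructor
  · intro X Y e
    induction X using Cat.FreeRefl.induction with | _ x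
    induction Y using Cat.FreeRefl.induction with | _ y
    exact congrArg _ (h.bij.1 e)
  · intro u
    obtain ⟨c, rfl⟩ := h.bij.2 u
    exact ⟨.mk c, rfl⟩

/-- Every word is an identity or ends with a non-identity letter. -/
lemma word_cases (h : Rigid π) {X : Cat.FreeRefl C} {z : C} (f : X ⟶ .mk z) :
    (∃ e : X = .mk z, f = eqToHom e) ∨ ∃ (y : C) (w : X ⟶ .mk y) (l : y ⟶ z),
      π.obj y < π.obj z ∧ f = w ≫ Cat.FreeRefl.homMk l := by
  -- Induction on words needs a variable target, so its form is carried by an equation.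
  suffices H : ∀ {X Y : Cat.FreeRefl C} (f : X ⟶ Y),
      (∃ e : X = Y, f = eqToHom e) ∨ ∃ (y z : C) (e : Y = .mk z) (w : X ⟶ .mk y) (l : y ⟶ z),
        π.obj y < π.obj z ∧ f = w ≫ Cat.FreeRefl.homMk l ≫ eqToHom e.symm by
    rcases H f with h | ⟨y, z', e, w, l, hl, rfl⟩
    · exact .inl h
    · obtain rfl : z = z' := congrArg (evalWord C).obj e
      exact .inr ⟨y, w, l, hl, by simp⟩
  intro X Y f
  induction f using Cat.FreeRefl.hom_induction with
  | id x => exact .inl ⟨rfl, Cat.FreeRefl.homMk_id x⟩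
  | @comp_homMk x y z f g ih =>
    rcases (leOfHom (π.map g)).eq_or_lt with e | e
    · obtain rfl := h.bij.1 e
      obtain rfl := h.endo g
      have : f ≫ Cat.FreeRefl.homMk (𝟙 y) = f := by
        rw [show Cat.FreeRefl.homMk (𝟙 y) = 𝟙 _ from Cat.FreeRefl.homMk_id y, Category.comp_id]
      rwa [this]
    · exact .inr ⟨y, z, rfl, f, g, e, by simp⟩

/-- A word is determined by its vertices and its composition. -/
lemma word_ext (h : Rigid π) {X Y : Cat.FreeRefl C} (f g : X ⟶ Y)
    (e : passSet π f = passSet π g) (e' : (evalWord C).map f = (evalWord C).map g) : f = g := by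
  induction hn : (passSet π f).card using Nat.strong_induction_on generalizing Y with
  | _ n ih =>
  subst hn
  -- An identity has a single vertex, whereas a word with a proper last letter also has the start of
  -- that letter.
  have key : ∀ {x : Cat.FreeRefl C} {y z : C} (w : x ⟶ .mk y) (l : y ⟶ z), π.obj y < π.obj z →
      ∀ e : x = .mk z, passSet π (w ≫ Cat.FreeRefl.homMk l) ≠ passSet π (eqToHom e) := by
    rintro x y z w l hl rfl e
    rw [eqToHom_refl, passSet_id] at e
    have : π.obj y ∈ passSet π (w ≫ Cat.FreeRefl.homMk l) := by
      simp [passSet_comp, passSet_homMk]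
    rw [e, Finset.mem_singleton] at this
    exact hl.ne this
  induction Y using Cat.FreeRefl.induction with | _ z
  rcases h.word_cases f with ⟨e1, rfl⟩ | ⟨y, w, l, hl, rfl⟩
  · rcases h.word_cases g with ⟨e2, rfl⟩ | ⟨y', w', l', hl', rfl⟩
    · rfl
    · exact (key _ _ hl' _ e.symm).elim
  · rcases h.word_cases g with ⟨e2, rfl⟩ | ⟨y', w', l', hl', rfl⟩
    · exact (key _ _ hl _ e).elim
    -- The last letter starts at the largest vertex below the end. Equal vertex sets therefore force
    -- equal starts, and cancellation in `C` separates the last letters from the rest.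
    · have a1 : ∀ {y y' : C} {w : X ⟶ .mk y} {w' : X ⟶ .mk y'} {l : y ⟶ z} {l' : y' ⟶ z},
          π.obj y < π.obj z → passSet π (w ≫ Cat.FreeRefl.homMk l) =
            passSet π (w' ≫ Cat.FreeRefl.homMk l') → π.obj y ≤ π.obj y' := by
        intro y y' w w' l l' hl e
        have : π.obj y ∈ passSet π (w ≫ Cat.FreeRefl.homMk l) := by
          simp [passSet_comp, passSet_homMk]
        rw [e, passSet_comp, passSet_homMk, Finset.mem_union, Finset.mem_insert,
          Finset.mem_singleton] at this
        rcases this with h | h | h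
        · exact (le_of_mem_passSet h).2
        · exact h.le
        · exact (hl.ne h).elim
      obtain rfl := h.bij.1 ((a1 hl e).antisymm (a1 hl' e.symm))
      simp only [Functor.map_comp, Cat.FreeRefl.lift_map] at e'
      obtain ⟨b1, b2⟩ := h.cancel e'
      have b3 : l = l' := b2
      rw [ih _ ?_ w w' ?_ b1 rfl, b3]
      · refine Finset.card_lt_card ?_
        rw [passSet_left w (Cat.FreeRefl.homMk l), Finset.filter_ssubset]
        exact ⟨π.obj z, target_mem_passSet (w ≫ Cat.FreeRefl.homMk l), not_le.2 hl⟩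
      · rw [passSet_left w (Cat.FreeRefl.homMk l), passSet_left w' (Cat.FreeRefl.homMk l'), e]

/-- By `word_ext` it suffices to compare vertex sets, which are cuts of that of the composite, and
compositions, which are governed by rigidity of `C`. For `interp`, `f` is split at its vertex
labelled by `b`. This is the induction step for iterated free categories. -/
lemma word (h : Rigid π) : Rigid (wordLabel π) where
  bij := h.wordLabel_bijective
  cancel {a b c f f' g g'} e := by
    have e' := congrArg (evalWord C).map e
    simp only [Functor.map_comp] at e'
    obtain ⟨h1, h2⟩ := h.cancel e'
    refine ⟨h.word_ext _ _ ?_ h1, h.word_ext _ _ ?_ h2⟩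
    · rw [passSet_left f g, passSet_left f' g', e]
    · rw [passSet_right f g, passSet_right f' g', e]
  interp {a b c d f g f' g'} e hle := by
    have hb : (wordLabel π).obj b ∈ passSet π f := by
      rw [passSet_left f g, Finset.mem_filter, e, passSet_comp]
      exact ⟨Finset.mem_union_left _ (target_mem_passSet f'), hle⟩
    obtain ⟨Z, k, m, e1, rfl⟩ := (mem_passSet_iff f _).1 hb
    obtain rfl := h.wordLabel_bijective.1 e1
    have e' := congrArg (evalWord C).map e
    simp only [Functor.map_comp, Category.assoc] at e'
    obtain ⟨h1, h2⟩ := h.cancel e'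
    have p1 : k = f' := h.word_ext _ _ (by
      rw [passSet_left k (m ≫ g), passSet_left f' g', ← e, Category.assoc]) h1
    have p2 : m ≫ g = g' := h.word_ext _ _ (by
      rw [passSet_right k (m ≫ g), passSet_right f' g', ← e, Category.assoc])
      (by rw [Functor.map_comp, h2])
    exact ⟨m, by rw [p1], p2⟩

/-- There is a word with a given composition and given vertices, if the composition factors through
these. -/
lemma exists_word (h : Rigid π) {a b : C} (f : a ⟶ b) (S : Finset P) (ha : π.obj a ∈ S)
    (hb : π.obj b ∈ S)
    (hS : ∀ u ∈ S, ∃ (c : C) (g : a ⟶ c) (g' : c ⟶ b), π.obj c = u ∧ g ≫ g' = f) :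
    ∃ w : Cat.FreeRefl.mk a ⟶ Cat.FreeRefl.mk b, (evalWord C).map w = f ∧ passSet π w = S := by
  induction S using Finset.strongInduction generalizing b with
  | H S ih =>
  rcases (leOfHom (π.map f)).eq_or_lt with e | e
  · obtain rfl := h.bij.1 e
    refine ⟨𝟙 _, ((evalWord C).map_id _).trans (h.endo f).symm, ?_⟩
    rw [passSet_id]
    refine Finset.Subset.antisymm (by simpa using ha) fun u hu => ?_
    obtain ⟨c, g, g', rfl, -⟩ := hS u hu
    exact Finset.mem_singleton.2 ((leOfHom (π.map g')).antisymm (leOfHom (π.map g)))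
  -- The last letter must start at the largest element of `S` other than the end. The remaining
  -- elements factor the initial part by `interp`, so induction applies to it.
  · have haS : π.obj a ∈ S.erase (π.obj b) := Finset.mem_erase.2 ⟨e.ne, ha⟩
    have hne : (S.erase (π.obj b)).Nonempty := ⟨_, haS⟩
    have hmax := (S.erase (π.obj b)).max'_mem hne
    obtain ⟨c, g, g', hc, rfl⟩ := hS _ (Finset.mem_of_mem_erase hmax)
    rw [← hc] at hmax
    obtain ⟨w, hw1, hw2⟩ := ih _ (Finset.erase_ssubset hb) g haS hmax (fun u hu => by
      obtain ⟨d, k, k', rfl, hk⟩ := hS u (Finset.mem_of_mem_erase hu)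
      obtain ⟨m, hm, -⟩ := h.interp hk.symm (hc ▸ Finset.le_max' _ _ hu)
      exact ⟨d, k, m, rfl, hm⟩)
    refine ⟨w ≫ Cat.FreeRefl.homMk g', ?_, ?_⟩
    · rw [Functor.map_comp, hw1, Cat.FreeRefl.lift_map]
      rfl
    · rw [passSet_comp, hw2, passSet_homMk]
      ext u
      have := Finset.mem_of_mem_erase hmax
      simp only [Finset.mem_union, Finset.mem_erase, Finset.mem_insert, Finset.mem_singleton]
      constructor
      · rintro (⟨-, h⟩ | rfl | rfl) <;> assumption
      · intro hu
        by_cases hub : u = π.obj b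
        · exact .inr (.inr hub)
        · exact .inl ⟨hub, hu⟩

end Rigid

end Words

/-! ### Vertices of the simplices of the resolution -/

lemma counitAt_zero (k : ℕ) : counitAt k 0 = (freePow k).whiskerLeft freeCat.ε := by
  cases k <;> rfl

lemma counitAt_succ (k : ℕ) (i : Fin (k + 1)) :
    counitAt (k + 1) i.succ = Functor.whiskerRight (counitAt k i) freeCat.toFunctor := rfl

lemma comultAt_zero (k : ℕ) : comultAt k 0 = (freePow k).whiskerLeft freeCat.δ := by
  cases k <;> rfl

lemma comultAt_succ (k : ℕ) (i : Fin (k + 1)) :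
    comultAt (k + 1) i.succ = Functor.whiskerRight (comultAt k i) freeCat.toFunctor := rfl

lemma augment_succ (k : ℕ) : augment (k + 1) = (freePow k).whiskerLeft freeCat.ε ≫ augment k := by
  rw [← counitAt_zero]
  rfl

lemma vertex_zero (q : ℕ) : vertex q 0 = Functor.whiskerRight (augment q) freeCat.toFunctor := by
  cases q <;> rfl

lemma vertex_succ (q : ℕ) (l : Fin (q + 1)) :
    vertex (q + 1) l.succ = (freePow (q + 1)).whiskerLeft freeCat.ε ≫ vertex q l := rfl

/-- The counit is natural with respect to transformations of endofunctors. -/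
lemma whiskerRight_counit {A B : Cat.{0, 0} ⥤ Cat.{0, 0}} (α : A ⟶ B) :
    Functor.whiskerRight α freeCat.toFunctor ≫ B.whiskerLeft freeCat.ε =
      A.whiskerLeft freeCat.ε ≫ α := by
  ext X : 2
  exact freeCat.ε.naturality (α.app X)

lemma counitAt_augment (k : ℕ) (i : Fin (k + 1)) : counitAt k i ≫ augment k = augment (k + 1) := by
  induction k with
  | zero =>
    obtain rfl : i = 0 := Fin.fin_one_eq_zero i
    rfl
  | succ k ih =>
    induction i using Fin.cases with
    | zero => rfl
    | succ i =>
      rw [counitAt_succ, augment_succ k, augment_succ (k + 1), ← ih i]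
      have := whiskerRight_counit (counitAt k i)
      exact (Category.assoc _ _ _).symm.trans ((congrArg (· ≫ augment k) this).trans
        (Category.assoc _ _ _))

lemma comult_counit (A : Cat.{0, 0} ⥤ Cat.{0, 0}) :
    A.whiskerLeft freeCat.δ ≫ (A ⋙ freeCat.toFunctor).whiskerLeft freeCat.ε =
      𝟙 (A ⋙ freeCat.toFunctor) := by
  ext X : 2
  exact freeCat.left_counit (A.obj X)

lemma comult_counit_comp {A B : Cat.{0, 0} ⥤ Cat.{0, 0}} (β : A ⟶ B) :
    A.whiskerLeft freeCat.δ ≫ Functor.whiskerRight (A.whiskerLeft freeCat.ε ≫ β) freeCat.toFunctor =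
      Functor.whiskerRight β freeCat.toFunctor := by
  ext X : 2
  have h := freeCat.right_counit (A.obj X)
  change freeCat.δ.app _ ≫ freeCat.toFunctor.map (freeCat.ε.app _ ≫ β.app X) = _
  rw [Functor.map_comp, ← Category.assoc, h, Category.id_comp]
  rfl

lemma comultAt_augment (k : ℕ) (i : Fin (k + 1)) :
    comultAt k i ≫ augment (k + 2) = augment (k + 1) := by
  induction k with
  | zero =>
    obtain rfl : i = 0 := Fin.fin_one_eq_zero i
    rw [comultAt_zero, augment_succ (0 + 1)]
    exact (Category.assoc _ _ _).symm.trans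
      ((congrArg (· ≫ augment (0 + 1)) (comult_counit (freePow 0))).trans (Category.id_comp _))
  | succ k ih =>
    induction i using Fin.cases with
    | zero =>
      rw [comultAt_zero, augment_succ (k + 2)]
      exact (Category.assoc _ _ _).symm.trans
        ((congrArg (· ≫ augment (k + 2)) (comult_counit (freePow (k + 1)))).trans
          (Category.id_comp _))
    | succ i =>
      rw [comultAt_succ, augment_succ (k + 2)]
      exact (Category.assoc _ _ _).symm.trans
        ((congrArg (· ≫ augment (k + 2)) (whiskerRight_counit (comultAt k i))).trans
        ((Category.assoc _ _ _).trans ((congrArg ((freePow (k + 1)).whiskerLeft freeCat.ε ≫ ·)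
          (ih i)).trans (augment_succ (k + 1)).symm)))

/-- For `i = 0` this is the recursion defining `vertex`. An inner face does not change the total
composition, which settles `l = 0`, and it commutes with the outermost counit by naturality, which
reduces `l`. -/
lemma resFace_vertex (q : ℕ) (i : Fin (q + 2)) (l : Fin (q + 1)) :
    resFace q i ≫ vertex q l = vertex (q + 1) (i.succAbove l) := by
  induction q with
  | zero =>
    obtain rfl : l = 0 := Fin.fin_one_eq_zero l
    induction i using Fin.cases with
    | zero => rfl
    | succ i =>
      rw [Fin.succ_succAbove_zero, vertex_zero, vertex_zero, ← counitAt_augment 0 i]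
      exact (Functor.whiskerRight_comp _ _ _).symm
  | succ q ih =>
    induction i using Fin.cases with
    | zero =>
      rw [Fin.succAbove_zero_apply]
      rfl
    | succ i =>
      induction l using Fin.cases with
      | zero =>
        rw [Fin.succ_succAbove_zero, vertex_zero, vertex_zero, ← counitAt_augment (q + 1) i]
        exact (Functor.whiskerRight_comp _ _ _).symm
      | succ l =>
        rw [Fin.succ_succAbove_succ, vertex_succ q, vertex_succ (q + 1), ← ih i l]
        exact (Category.assoc _ _ _).symm.trans
          ((congrArg (· ≫ vertex q l) (whiskerRight_counit (counitAt (q + 1) i))).trans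
          (Category.assoc _ _ _))

lemma resDegen_vertex_zero (q : ℕ) (i : Fin (q + 1)) :
    resDegen q i ≫ vertex (q + 1) 0 = vertex q 0 := by
  rw [vertex_zero, vertex_zero]
  induction i using Fin.cases with
  | zero =>
    rw [augment_succ, resDegen, comultAt_zero]
    exact comult_counit_comp (augment q)
  | succ i =>
    -- An index of the form `i.succ` forces `q` to be positive, as `comultAt_succ` requires.
    obtain ⟨q, rfl⟩ : ∃ q', q = q' + 1 := ⟨q - 1, by have := i.2; omega⟩
    rw [resDegen, comultAt_succ, ← comultAt_augment q i]
    exact (Functor.whiskerRight_comp _ _ _).symm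

lemma resDegen_zero_vertex (q : ℕ) (l : Fin (q + 1)) :
    resDegen q 0 ≫ vertex (q + 1) l.succ = vertex q l := by
  rw [vertex_succ, resDegen, comultAt_zero]
  exact (Category.assoc _ _ _).symm.trans
    ((congrArg (· ≫ vertex q l) (comult_counit (freePow q))).trans (Category.id_comp _))

lemma resDegen_vertex (q : ℕ) (i : Fin (q + 1)) (l : Fin (q + 2)) :
    resDegen q i ≫ vertex (q + 1) l = vertex q (i.predAbove l) := by
  induction l using Fin.cases with
  | zero => rw [Fin.predAbove_right_zero, resDegen_vertex_zero]
  | succ l =>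
    induction q with
    | zero =>
      obtain rfl : i = 0 := Fin.fin_one_eq_zero i
      obtain rfl : l = 0 := Fin.fin_one_eq_zero l
      exact resDegen_zero_vertex 0 0
    | succ q ih =>
      induction i using Fin.cases with
      | zero => rw [Fin.predAbove_zero_succ, resDegen_zero_vertex]
      | succ i =>
        have e : resDegen q i ≫ vertex (q + 1) l = vertex q (i.predAbove l) := by
          induction l using Fin.cases with
          | zero => rw [Fin.predAbove_right_zero, resDegen_vertex_zero]
          | succ l => exact ih i l
        rw [Fin.succ_predAbove_succ, vertex_succ q, vertex_succ (q + 1), ← e]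
        exact (Category.assoc _ _ _).symm.trans
          ((congrArg (· ≫ vertex (q + 1) l) (whiskerRight_counit (comultAt q i))).trans
          (Category.assoc _ _ _))

/-! ### Vertex sets of morphisms in the iterated free categories -/

section Labelled

variable {P : Type} [LinearOrder P] {C : Cat.{0, 0}} (π : C ⥤ P)

/-- The label of an object of an iterated free category. -/
def powLabel : (k : ℕ) → (freePow k).obj C ⥤ P
  | 0 => π
  | k + 1 => wordLabel (C := (freePow k).obj C) (powLabel k)

lemma augment_comp (k : ℕ) : ((augment k).app C).toFunctor ⋙ π = powLabel π k := by
  induction k with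
  | zero => rfl
  | succ k ih =>
    rw [augment_succ, powLabel, ← ih]
    rfl

lemma label_eq {q : ℕ} (X : (res q).obj C) : π.obj (label X) = (powLabel π (q + 1)).obj X :=
  congrArg (fun F => F.obj X) (augment_comp π (q + 1))

/-- The set of the labels of the vertices of the `l`-th vertex of a `q`-simplex of morphisms. -/
def vset (q : ℕ) (l : Fin (q + 1)) {X Y : (res q).obj C} (f : X ⟶ Y) : Finset P :=
  passSet (C := C) π (((vertex q l).app C).toFunctor.map f)

lemma rigid_powLabel (h : Rigid π) : ∀ k, Rigid (powLabel π k)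
  | 0 => h
  | k + 1 => (rigid_powLabel h k).word

/-- The zeroth vertex only composes inside the letters of the outermost word, so the breaks of that
word survive. -/
lemma vset_zero (q : ℕ) {X Y : (res q).obj C} (f : X ⟶ Y) :
    vset π q 0 f = passSet (C := (freePow q).obj C) (powLabel π q) f := by
  rw [← augment_comp, vset, vertex_zero]
  exact passSet_freeReflMap (C := C) (D := (freePow q).obj C) (π := π)
    ((augment q).app C).toFunctor f

lemma wordLabel_vertex (q : ℕ) (l : Fin (q + 1)) (X : (res q).obj C) :
    (wordLabel (C := C) π).obj (((vertex q l).app C).toFunctor.obj X) =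
      (powLabel π (q + 1)).obj X := by
  have : ∀ (q : ℕ) (l : Fin (q + 1)), vertex q l ≫ augment 1 = augment (q + 1) := by
    intro q
    induction q with
    | zero =>
      intro l
      obtain rfl : l = 0 := Fin.fin_one_eq_zero l
      rw [vertex_zero, augment_succ]
      exact (Category.assoc _ _ _).symm.trans
        ((congrArg (· ≫ augment 0) (whiskerRight_counit (augment 0))).trans (Category.comp_id _))
    | succ q ih =>
      intro l
      induction l using Fin.cases with
      | zero =>
        rw [vertex_zero, augment_succ 0, augment_succ (q + 1)]
        exact (Category.assoc _ _ _).symm.trans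
          ((congrArg (· ≫ augment 0) (whiskerRight_counit (augment (q + 1)))).trans
            (Category.comp_id _))
      | succ l =>
        exact (Category.assoc _ _ _).trans ((congrArg ((freePow (q + 1)).whiskerLeft freeCat.ε ≫ ·)
          (ih l)).trans (augment_succ (q + 1)).symm)
  rw [← label_eq]
  exact congrArg (fun t : res q ⟶ 𝟭 Cat.{0, 0} => π.obj ((t.app C).toFunctor.obj X)) (this q l)

end Labelled

section Simplices

variable {P : Type} [LinearOrder P]

/-- A labelling which identifies a category with a linear order. -/
structure IsOrderLabel {C : Type} [Category.{0} C] (π : C ⥤ P) : Prop where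
  bij : Function.Bijective π.obj
  thin {a b : C} (f g : a ⟶ b) : f = g
  full {a b : C} : π.obj a ≤ π.obj b → Nonempty (a ⟶ b)

variable {C : Cat.{0, 0}} {π : C ⥤ P}

lemma IsOrderLabel.rigid (h : IsOrderLabel π) : Rigid π where
  bij := h.bij
  cancel _ := ⟨h.thin _ _, h.thin _ _⟩
  interp _ hle := (h.full hle).elim fun m => ⟨m, h.thin _ _, h.thin _ _⟩

lemma source_mem_vset {q : ℕ} (l : Fin (q + 1)) {X Y : (res q).obj C} (f : X ⟶ Y) :
    (powLabel π (q + 1)).obj X ∈ vset π q l f := by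
  rw [← wordLabel_vertex π q l X]
  exact source_mem_passSet (C := C) (((vertex q l).app C).toFunctor.map f)

lemma le_of_mem_vset {q : ℕ} {l : Fin (q + 1)} {X Y : (res q).obj C} {f : X ⟶ Y} {u : P}
    (hu : u ∈ vset π q l f) :
    (powLabel π (q + 1)).obj X ≤ u ∧ u ≤ (powLabel π (q + 1)).obj Y := by
  rw [← wordLabel_vertex π q l X, ← wordLabel_vertex π q l Y]
  exact le_of_mem_passSet (C := C) hu

lemma vset_left {q : ℕ} (l : Fin (q + 1)) {X Y Z : (res q).obj C} (f : X ⟶ Y) (g : Y ⟶ Z) :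
    vset π q l f = (vset π q l (f ≫ g)).filter (· ≤ (powLabel π (q + 1)).obj Y) := by
  rw [← wordLabel_vertex π q l Y, vset, vset, Functor.map_comp]
  exact passSet_left (C := C) _ _

lemma vset_right {q : ℕ} (l : Fin (q + 1)) {X Y Z : (res q).obj C} (f : X ⟶ Y) (g : Y ⟶ Z) :
    vset π q l g = (vset π q l (f ≫ g)).filter ((powLabel π (q + 1)).obj Y ≤ ·) := by
  rw [← wordLabel_vertex π q l Y, vset, vset, Functor.map_comp]
  exact passSet_right (C := C) _ _

/-- The coarsest vertex of a simplex of morphisms describes its factorizations. -/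
lemma mem_vset_zero_iff {q : ℕ} {X Y : (res q).obj C} (f : X ⟶ Y) (u : P) :
    u ∈ vset π q 0 f ↔ ∃ (Z : (res q).obj C) (g : X ⟶ Z) (h : Z ⟶ Y),
      (powLabel π (q + 1)).obj Z = u ∧ g ≫ h = f := by
  rw [vset_zero]
  exact mem_passSet_iff (C := (freePow q).obj C) f u

/-- Passing from one vertex to the next composes the outermost word. A factorization before
composing gives one afterwards, so breaks are only added. -/
lemma vset_monotone (q : ℕ) {X Y : (res q).obj C} (f : X ⟶ Y) :
    Monotone fun l => vset π q l f := by
  induction q with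
  | zero =>
    intro l l' _
    rw [Fin.fin_one_eq_zero l, Fin.fin_one_eq_zero l']
  | succ q ih =>
    refine Fin.monotone_iff_le_succ.2 fun l => ?_
    induction l using Fin.cases with
    | zero =>
      intro u hu
      obtain ⟨Z, g, h, rfl, rfl⟩ := (mem_vset_zero_iff f u).1 hu
      refine (mem_vset_zero_iff (q := q) _ _).2 ⟨(evalWord ((freePow (q + 1)).obj C)).obj Z,
        (evalWord ((freePow (q + 1)).obj C)).map g, (evalWord ((freePow (q + 1)).obj C)).map h,
        rfl, ?_⟩
      exact ((evalWord ((freePow (q + 1)).obj C)).map_comp g h).symm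
    | succ l =>
      exact ih ((evalWord ((freePow (q + 1)).obj C)).map f) (Fin.castSucc_le_succ l)

/-- A simplex of morphisms is determined by the vertex sets. -/
lemma vset_ext (h : IsOrderLabel π) (q : ℕ) {X Y : (res q).obj C} (f g : X ⟶ Y)
    (e : ∀ l, vset π q l f = vset π q l g) : f = g := by
  induction q with
  | zero =>
    refine h.rigid.word_ext (C := C) f g ?_ (h.thin _ _)
    have := e 0
    rwa [vset_zero, vset_zero] at this
  | succ q ih =>
    -- The composition of the outermost word has the vertex sets of `f` shifted by one, so induction
    -- identifies the compositions.
    refine (rigid_powLabel π h.rigid (q + 1)).word_ext (C := (freePow (q + 1)).obj C) f g ?_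
      (ih _ _ fun l => e l.succ)
    have := e 0
    rwa [vset_zero, vset_zero] at this

/-- Every chain of sets that contain the end points occurs. -/
lemma exists_vset (h : IsOrderLabel π) (q : ℕ) (X Y : (res q).obj C) (V : Fin (q + 1) → Finset P)
    (hV : Monotone V) (hX : (powLabel π (q + 1)).obj X ∈ V 0)
    (hY : (powLabel π (q + 1)).obj Y ∈ V 0)
    (hb : ∀ l, ∀ u ∈ V l, (powLabel π (q + 1)).obj X ≤ u ∧ u ≤ (powLabel π (q + 1)).obj Y) :
    ∃ f : X ⟶ Y, ∀ l, vset π q l f = V l := by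
  induction q with
  | zero =>
    obtain ⟨f⟩ := h.full (hb 0 _ hX).2
    obtain ⟨w, -, hw⟩ := h.rigid.exists_word (C := C) f (V 0) hX hY (fun u hu => by
      obtain ⟨c, rfl⟩ := h.bij.2 u
      obtain ⟨g⟩ := h.full (hb 0 _ hu).1
      obtain ⟨g'⟩ := h.full (hb 0 _ hu).2
      exact ⟨c, g, g', rfl, h.thin _ _⟩)
    refine ⟨w, fun l => ?_⟩
    rw [Fin.fin_one_eq_zero l]
    exact (vset_zero (X := X) (Y := Y) π 0 w).trans hw
  | succ q ih =>
    -- The composition `d_0` of the desired simplex is built first, from the shifted chain. Since `V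
    -- 0 ⊆ V 1`, it factors through every element of `V 0`, hence lifts to a word with these breaks.
    obtain ⟨f, hf⟩ := ih ((evalWord ((freePow (q + 1)).obj C)).obj X)
      ((evalWord ((freePow (q + 1)).obj C)).obj Y) (fun l => V l.succ)
      (fun l l' hl => hV (Fin.succ_le_succ_iff.2 hl)) (hV (Fin.zero_le _) hX)
      (hV (Fin.zero_le _) hY) (fun l => hb l.succ)
    obtain ⟨w, hw, hw'⟩ := (rigid_powLabel π h.rigid (q + 1)).exists_word
      (C := (freePow (q + 1)).obj C) f (V 0) hX hY (fun u hu => by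
        have : u ∈ vset π q 0 f := by
          rw [hf 0]
          exact hV (Fin.zero_le _) hu
        exact (mem_vset_zero_iff f u).1 this)
    refine ⟨w, fun l => ?_⟩
    induction l using Fin.cases with
    | zero =>
      exact (vset_zero (X := X) (Y := Y) π (q + 1) w).trans hw'
    | succ l =>
      rw [← hf l, ← hw]
      rfl

lemma vset_face (q : ℕ) (i : Fin (q + 2)) (l : Fin (q + 1)) {X Y : (res (q + 1)).obj C}
    (f : X ⟶ Y) :
    vset π q l (((resFace q i).app C).toFunctor.map f) = vset π (q + 1) (i.succAbove l) f :=
  congrArg (fun t : res (q + 1) ⟶ res 0 => passSet (C := C) π ((t.app C).toFunctor.map f))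
    (resFace_vertex q i l)

lemma vset_degen (q : ℕ) (i : Fin (q + 1)) (l : Fin (q + 2)) {X Y : (res q).obj C}
    (f : X ⟶ Y) :
    vset π (q + 1) l (((resDegen q i).app C).toFunctor.map f) = vset π q (i.predAbove l) f :=
  congrArg (fun t : res q ⟶ res 0 => passSet (C := C) π ((t.app C).toFunctor.map f))
    (resDegen_vertex q i l)

lemma powLabel_face (q : ℕ) (i : Fin (q + 2)) (X : (res (q + 1)).obj C) :
    (powLabel π (q + 1)).obj (((resFace q i).app C).toFunctor.obj X) =
      (powLabel π (q + 2)).obj X := by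
  rw [← augment_comp, ← augment_comp, ← counitAt_augment (q + 1) i]
  rfl

lemma powLabel_degen (q : ℕ) (i : Fin (q + 1)) (X : (res q).obj C) :
    (powLabel π (q + 2)).obj (((resDegen q i).app C).toFunctor.obj X) =
      (powLabel π (q + 1)).obj X := by
  rw [← augment_comp, ← augment_comp, ← comultAt_augment q i]
  rfl

lemma powLabel_map {Q : Type} [LinearOrder Q] {D : Cat.{0, 0}} {ρ : D ⥤ Q} (F : C ⟶ D) (m : P ⥤ Q)
    (hF : F.toFunctor ⋙ ρ = π ⋙ m) (k : ℕ) (X : (freePow k).obj C) :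
    (powLabel ρ k).obj (((freePow k).map F).toFunctor.obj X) = m.obj ((powLabel π k).obj X) := by
  rw [← augment_comp, ← augment_comp]
  refine (congrArg (fun t : (freePow k).obj C ⟶ D => ρ.obj (t.toFunctor.obj X))
    ((augment k).naturality F)).trans ?_
  exact congrArg (fun G : C ⥤ Q => G.obj (((augment k).app C).toFunctor.obj X)) hF

lemma vset_map {Q : Type} [LinearOrder Q] {D : Cat.{0, 0}} {ρ : D ⥤ Q} (F : C ⟶ D) (m : P ⥤ Q)
    (hF : F.toFunctor ⋙ ρ = π ⋙ m) (q : ℕ) (l : Fin (q + 1)) {X Y : (res q).obj C} (f : X ⟶ Y) :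
    vset ρ q l (((res q).map F).toFunctor.map f) = (vset π q l f).image m.obj := by
  refine (congrArg (fun t : (res q).obj C ⟶ (res 0).obj D =>
    passSet (C := D) ρ (t.toFunctor.map f)) ((vertex q l).naturality F)).trans ?_
  refine (passSet_freeReflMap (C := D) (D := C) (π := ρ) F.toFunctor _).trans ?_
  rw [hF]
  exact passSet_map (C := C) m _

end Simplices

/-! ### Strings of simplices of morphisms -/

section Strings

variable {P : Type} [LinearOrder P] {C : Cat.{0, 0}} (π : C ⥤ P) {p q : ℕ}

/-- The labels of the objects of a string. -/
def labels (x : ComposableArrows ((res q).obj C) p) (k : Fin (p + 1)) : P :=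
  (powLabel π (q + 1)).obj (x.obj k)

/-- The vertex sets of the composite of a string. -/
def vsets (x : ComposableArrows ((res q).obj C) p) (l : Fin (q + 1)) : Finset P :=
  vset π q l x.hom

variable {π}

lemma labels_monotone (x : ComposableArrows ((res q).obj C) p) : Monotone (labels π x) :=
  fun _ _ hkl => leOfHom ((powLabel π (q + 1)).map (x.map (homOfLE hkl)))

lemma vsets_monotone (x : ComposableArrows ((res q).obj C) p) : Monotone (vsets π x) :=
  vset_monotone q x.hom

/-- Any arrow of the string is a middle factor of the full composite, so its vertex sets are cut out
by the labels of its ends. Hence the composite and the labels carry all the information. -/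
lemma vset_map_eq (x : ComposableArrows ((res q).obj C) p) (l : Fin (q + 1)) {i j : Fin (p + 1)}
    (h : i ⟶ j) :
    vset π q l (x.map h) = (vsets π x l).filter (fun u => labels π x i ≤ u ∧ u ≤ labels π x j) := by
  have e : x.hom =
      (x.map (homOfLE (Fin.zero_le i)) ≫ x.map h) ≫ x.map (homOfLE (Fin.le_last j)) := by
    rw [← Functor.map_comp, ← Functor.map_comp]
    rfl
  rw [vset_right l (x.map (homOfLE (Fin.zero_le i))) (x.map h),
    vset_left l _ (x.map (homOfLE (Fin.le_last j))), ← e, Finset.filter_filter]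
  exact Finset.filter_congr fun u _ => and_comm

lemma labels_mem_vsets (x : ComposableArrows ((res q).obj C) p) (k : Fin (p + 1))
    (l : Fin (q + 1)) :
    labels π x k ∈ vsets π x l := by
  have h := source_mem_vset (π := π) l (x.map (𝟙 k))
  rw [vset_map_eq, Finset.mem_filter] at h
  exact h.1

lemma le_of_mem_vsets {x : ComposableArrows ((res q).obj C) p} {l : Fin (q + 1)} {u : P}
    (hu : u ∈ vsets π x l) : labels π x 0 ≤ u ∧ u ≤ labels π x (Fin.last p) :=
  le_of_mem_vset hu

/-- A string is determined by its labels and vertex sets. -/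
lemma string_ext (h : IsOrderLabel π) {x y : ComposableArrows ((res q).obj C) p}
    (h1 : labels π x = labels π y) (h2 : vsets π x = vsets π y) : x = y := by
  have ho : x.obj = y.obj := funext fun k =>
    (rigid_powLabel π h.rigid (q + 1)).bij.1 (congrFun h1 k)
  have key : ∀ (l : Fin (q + 1)) (i j : Fin (p + 1)) (f : i ⟶ j),
      vset π q l (x.map f) = vset π q l (y.map f) := by
    intro l i j f
    rw [vset_map_eq, vset_map_eq, h1, h2]
  obtain ⟨xo, xm, xi, xc⟩ := x
  obtain ⟨yo, ym, yi, yc⟩ := y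
  change xo = yo at ho
  subst ho
  congr
  funext i j f
  exact vset_ext h q _ _ fun l => key l i j f

/-- All labels and vertex sets that satisfy the necessary conditions occur. -/
lemma exists_string (h : IsOrderLabel π) (α : Fin (p + 1) → P) (hα : Monotone α)
    (V : Fin (q + 1) → Finset P) (hV : Monotone V) (hαV : ∀ k, α k ∈ V 0)
    (hVα : ∀ l, ∀ u ∈ V l, α 0 ≤ u ∧ u ≤ α (Fin.last p)) :
    ∃ x : ComposableArrows ((res q).obj C) p, labels π x = α ∧ vsets π x = V := by
  have hr := rigid_powLabel π h.rigid (q + 1)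
  choose X hX using fun k => hr.bij.2 (α k)
  obtain ⟨f, hf⟩ := exists_vset h q (X 0) (X (Fin.last p)) V hV (by rw [hX]; exact hαV _)
    (by rw [hX]; exact hαV _) (by rw [hX, hX]; exact hVα)
  -- Only the total composite `f` is chosen. Since `α k ∈ V 0`, it factors through each `X k`;
  -- `interp` then supplies the arrows between the `X k`, and cancellation makes them functorial.
  have hfac : ∀ k, ∃ (g : X 0 ⟶ X k) (g' : X k ⟶ X (Fin.last p)), g ≫ g' = f := by
    intro k
    have hk : α k ∈ vset π q 0 f := by
      rw [hf]
      exact hαV k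
    obtain ⟨Z, g, g', e, e'⟩ := (mem_vset_zero_iff f _).1 hk
    obtain rfl : Z = X k := hr.bij.1 (e.trans (hX k).symm)
    exact ⟨g, g', e'⟩
  choose g g' hg using hfac
  have hm : ∀ i j : Fin (p + 1), i ≤ j → ∃ m : X i ⟶ X j, g i ≫ m = g j := by
    intro i j hij
    obtain ⟨m, hm, -⟩ := hr.interp ((hg j).trans (hg i).symm) (by
      rw [hX, hX]
      exact hα hij)
    exact ⟨m, hm⟩
  choose m hm using hm
  have uniq : ∀ {i j : Fin (p + 1)} (a b : X i ⟶ X j), g i ≫ a = g i ≫ b → a = b :=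
    fun a b e => (hr.cancel e).2
  let x : ComposableArrows ((res q).obj C) p :=
    { obj := X
      map := fun {i j} f => m i j (leOfHom f)
      map_id := fun i => uniq _ _ (by rw [hm]; exact (Category.comp_id _).symm)
      map_comp := fun {i j k} a b => uniq _ _ (by
        rw [hm, ← Category.assoc, hm, hm]) }
  refine ⟨x, funext hX, funext fun l => ?_⟩
  rw [← hf l]
  have e0 : g 0 = 𝟙 _ := hr.endo _
  have e1 : g' (Fin.last p) = 𝟙 _ := hr.endo _
  have : m 0 (Fin.last p) (Fin.zero_le _) = f := by
    have := hg (Fin.last p)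
    rw [e1, Category.comp_id, ← hm 0 (Fin.last p) (Fin.zero_le _), e0, Category.id_comp] at this
    exact this
  exact congrArg (vset π q l) this

lemma finite_string [Finite P] (h : IsOrderLabel π) (p q : ℕ) :
    Finite (ComposableArrows ((res q).obj C) p) :=
  Finite.of_injective (fun x => (labels π x, vsets π x)) fun _ _ e =>
    string_ext h (congrArg Prod.fst e) (congrArg Prod.snd e)

/-! ### Simplicial operators -/

lemma vsets_bar {p' : ℕ} (θ : SimplexCategory.mk p' ⟶ SimplexCategory.mk p) (x : BarSimplex C p q)
    (l : Fin (q + 1)) :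
    vsets π (((bar q).obj C).map θ.op x) l = (vsets π x l).filter
      (fun u => labels π x (θ 0) ≤ u ∧ u ≤ labels π x (θ (Fin.last p'))) :=
  vset_map_eq (π := π) x l (homOfLE (θ.toOrderHom.monotone (Fin.zero_le (Fin.last p'))))

lemma labels_barFace (i : Fin (q + 2)) (x : BarSimplex C p (q + 1)) :
    labels π (barFace i x) = labels π x :=
  funext fun k => powLabel_face q i (x.obj k)

lemma vsets_barFace (i : Fin (q + 2)) (x : BarSimplex C p (q + 1)) :
    vsets π (barFace i x) = vsets π x ∘ i.succAbove :=
  funext fun l => vset_face q i l x.hom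

lemma labels_barDegen (i : Fin (q + 1)) (x : BarSimplex C p q) :
    labels π (barDegen i x) = labels π x :=
  funext fun k => powLabel_degen q i (x.obj k)

lemma vsets_barDegen (i : Fin (q + 1)) (x : BarSimplex C p q) :
    vsets π (barDegen i x) = vsets π x ∘ i.predAbove :=
  funext fun l => vset_degen q i l x.hom

section

variable {Q : Type} [LinearOrder Q] {D : Cat.{0, 0}} {ρ : D ⥤ Q}

lemma labels_map (F : C ⟶ D) (m : P ⥤ Q) (hF : F.toFunctor ⋙ ρ = π ⋙ m) (x : BarSimplex C p q) :
    labels ρ (((bar q).map F).app (op (SimplexCategory.mk p)) x) = m.obj ∘ labels π x :=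
  funext fun k => powLabel_map F m hF (q + 1) (x.obj k)

lemma vsets_map (F : C ⟶ D) (m : P ⥤ Q) (hF : F.toFunctor ⋙ ρ = π ⋙ m) (x : BarSimplex C p q)
    (l : Fin (q + 1)) :
    vsets ρ (((bar q).map F).app (op (SimplexCategory.mk p)) x) l =
      (vsets π x l).image m.obj :=
  vset_map F m hF q l x.hom

end

/-! ### Comparison with the coordinates -/

lemma passes_iff (h : IsOrderLabel π) (x : ComposableArrows ((res q).obj C) p) (l : Fin (q + 1))
    (u : C) : Passes x l u ↔ π.obj u ∈ vsets π x l := by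
  refine Iff.trans ?_ (mem_passSet_iff (C := C) (π := π) _ _).symm
  refine exists_congr fun Z => exists_congr fun f => exists_congr fun g => and_congr ?_ Iff.rfl
  rw [← h.bij.1.eq_iff, label_eq]
  rfl

lemma label_eq_iff (h : IsOrderLabel π) (x : ComposableArrows ((res q).obj C) p) (k : Fin (p + 1))
    (u : C) : label (x.obj k) = u ↔ labels π x k = π.obj u := by
  rw [← h.bij.1.eq_iff, label_eq]
  rfl

end Strings

/-- The identity labelling of the category `[n]`. -/
def idLabel (n : ℕ) : SimplexCategory.toCat.obj (SimplexCategory.mk n) ⥤ Fin (n + 1) :=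
  𝟭 (Fin (n + 1))

lemma isOrderLabel_idLabel (n : ℕ) : IsOrderLabel (idLabel n) where
  bij := Function.bijective_id
  thin f g := Subsingleton.elim (α := @Quiver.Hom (Fin (n + 1)) _ _ _) f g
  full h := ⟨homOfLE (X := Fin (n + 1)) h⟩

lemma toCat_map_idLabel {m n : ℕ} (θ : SimplexCategory.mk m ⟶ SimplexCategory.mk n) :
    (SimplexCategory.toCat.map θ).toFunctor ⋙ idLabel n =
      idLabel m ⋙ θ.toOrderHom.monotone.functor := rfl

/-! ### The barycentric coordinates of the image point -/

section Gap

variable {n : ℕ}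

/-- The maximum of `min (t v) (t w)` over all `v < u < w`, and zero if there are none. -/
def gap (t : Fin (n + 1) → ℝ) (u : Fin (n + 1)) : ℝ :=
  ⨆ vw : {vw : Fin (n + 1) × Fin (n + 1) // vw.1 < u ∧ u < vw.2}, min (t vw.1.1) (t vw.1.2)

lemma gap_nonneg {t : Fin (n + 1) → ℝ} (ht : ∀ u, 0 ≤ t u) (u : Fin (n + 1)) : 0 ≤ gap t u :=
  Real.iSup_nonneg fun _ => le_min (ht _) (ht _)

lemma min_le_gap (t : Fin (n + 1) → ℝ) {v u w : Fin (n + 1)} (hv : v < u) (hw : u < w) :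
    min (t v) (t w) ≤ gap t u :=
  le_ciSup (f := fun vw : {vw : Fin (n + 1) × Fin (n + 1) // vw.1 < u ∧ u < vw.2} =>
    min (t vw.1.1) (t vw.1.2)) (Set.finite_range _).bddAbove ⟨(v, w), hv, hw⟩

lemma gap_le {t : Fin (n + 1) → ℝ} {u : Fin (n + 1)} {c : ℝ} (hc : 0 ≤ c)
    (h : ∀ v w, v < u → u < w → min (t v) (t w) ≤ c) : gap t u ≤ c :=
  Real.iSup_le (fun vw => h _ _ vw.2.1 vw.2.2) hc

lemma exists_of_lt_gap {t : Fin (n + 1) → ℝ} {u : Fin (n + 1)} {c : ℝ} (hc : 0 ≤ c)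
    (h : c < gap t u) : ∃ v w, v < u ∧ u < w ∧ c < t v ∧ c < t w := by
  by_contra! H
  refine h.not_ge (gap_le hc fun v w hv hw => ?_)
  by_cases hc' : c < t v
  · exact (min_le_right _ _).trans (H v w hv hw hc')
  · exact (min_le_left _ _).trans (not_lt.1 hc')

lemma gap_smul {c : ℝ} (hc : 0 ≤ c) (t : Fin (n + 1) → ℝ) (u : Fin (n + 1)) :
    gap (fun v => c * t v) u = c * gap t u := by
  simp only [gap]
  rw [Real.mul_iSup_of_nonneg hc]
  exact congrArg _ (funext fun vw => (mul_min_of_nonneg _ _ hc).symm)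

lemma continuous_gap (u : Fin (n + 1)) :
    Continuous fun t : Fin (n + 1) → ℝ => gap t u := by
  rcases isEmpty_or_nonempty {vw : Fin (n + 1) × Fin (n + 1) // vw.1 < u ∧ u < vw.2} with h | h
  · simp only [gap, Real.iSup_of_isEmpty]
    exact continuous_const
  · have : (fun t : Fin (n + 1) → ℝ => gap t u) = fun t => Finset.univ.sup' Finset.univ_nonempty
        fun vw : {vw : Fin (n + 1) × Fin (n + 1) // vw.1 < u ∧ u < vw.2} =>
          min (t vw.1.1) (t vw.1.2) := by
      funext t
      rw [Finset.sup'_univ_eq_ciSup]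
      rfl
    rw [this]
    exact Continuous.finset_sup'_apply _ fun vw _ =>
      (continuous_apply _).min (continuous_apply _)

/-! ### The equation that recovers `t` and `s` from `a` -/

/-- The numbers `t_u` of a point with given unnormalized coordinates `a_u`. -/
def IsGapSolution (a t : Fin (n + 1) → ℝ) : Prop :=
  ∀ u, t u = max 0 (a u - gap t u)

namespace IsGapSolution

variable {a t t' : Fin (n + 1) → ℝ}

lemma nonneg (h : IsGapSolution a t) (u : Fin (n + 1)) : 0 ≤ t u := by
  rw [h u]
  exact le_max_left _ _

lemma gap_lt (h : IsGapSolution a t) (h' : IsGapSolution a t') {u : Fin (n + 1)}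
    (hu : t u < t' u) : gap t' u < gap t u := by
  by_contra! H
  refine hu.not_ge ?_
  rw [h u, h' u]
  exact max_le_max le_rfl (by linarith)

/-- Since no pair around `u` has both `t`-values above `gap t u`, on one side of `u` all values of
`t` are at most `gap t u`. The witness of the larger `gap t' u` on that side has `t' > gap t u ≥ t`,
and its own gap is bounded by the values on that side. -/
lemma exists_gap_lt (h : IsGapSolution a t) {u : Fin (n + 1)}
    (hu : gap t u < gap t' u) : ∃ v, t v < t' v ∧ gap t v ≤ gap t u := by
  obtain ⟨v, w, hv, hw, h1, h2⟩ := exists_of_lt_gap (gap_nonneg h.nonneg u) hu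
  by_cases hl : ∀ x, x < u → t x ≤ gap t u
  · exact ⟨v, (hl v hv).trans_lt h1, gap_le (gap_nonneg h.nonneg u) fun x y hx _ =>
      (min_le_left _ _).trans (hl x (hx.trans hv))⟩
  · push Not at hl
    obtain ⟨x, hx, hxu⟩ := hl
    have hr : ∀ y, u < y → t y ≤ gap t u := fun y hy => by
      rcases min_le_iff.1 (min_le_gap t hx hy) with H | H
      · exact (H.not_gt hxu).elim
      · exact H
    exact ⟨w, (hr w hw).trans_lt h2, gap_le (gap_nonneg h.nonneg u) fun x y _ hy =>
      (min_le_right _ _).trans (hr y (hw.trans hy))⟩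

/-- Minimal counterexample, ordered by the smaller of the two gaps: `gap_lt` turns the discrepancy
at `u` into a strict inequality of gaps, `exists_gap_lt` moves it to some `v`, and `gap_lt` at `v`
gives a strictly smaller gap. -/
lemma unique (h : IsGapSolution a t) (h' : IsGapSolution a t') : t = t' := by
  by_contra hne
  obtain ⟨u₀, hu₀⟩ := Function.ne_iff.1 hne
  obtain ⟨u, hu, hmin⟩ := Finset.exists_min_image (Finset.univ.filter fun u => t u ≠ t' u)
    (fun u => min (gap t u) (gap t' u)) ⟨u₀, by simpa using hu₀⟩
  simp only [Finset.mem_filter, Finset.mem_univ, true_and] at hu hmin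
  rcases hu.lt_or_gt with hlt | hlt
  · have hg := h.gap_lt h' hlt
    obtain ⟨v, hv, hvu⟩ := h'.exists_gap_lt hg
    have := hmin v hv.ne'
    have h3 := h'.gap_lt h hv
    rw [min_eq_right hg.le, min_eq_left h3.le] at this
    linarith
  · have hg := h'.gap_lt h hlt
    obtain ⟨v, hv, hvu⟩ := h.exists_gap_lt hg
    have := hmin v hv.ne
    have h3 := h.gap_lt h' hv
    rw [min_eq_left hg.le, min_eq_right h3.le] at this
    linarith

end IsGapSolution

open scoped NNReal in
/-- On an interval with given maxima to the left and to the right, the solution is found by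
removing an end point on the side of the smaller maximum. -/
lemma exists_interval_solution (a : ℕ → ℝ≥0) (k i : ℕ) (L R : ℝ≥0) :
    ∃ t : ℕ → ℝ≥0, ∀ u ∈ Finset.Ico i (i + k), t u =
      a u - min (L ⊔ (Finset.Ico i u).sup t) (R ⊔ (Finset.Ico (u + 1) (i + k)).sup t) := by
  induction k generalizing i L R with
  | zero => exact ⟨a, by simp⟩
  | succ k ih =>
    -- At the end next to the smaller outer maximum, the minimum equals that maximum whatever
    -- happens inside. This forces `t` there, and the value is then absorbed into the outer maximum.
    rcases le_total L R with hLR | hLR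
    · obtain ⟨t, ht⟩ := ih (i + 1) (L ⊔ (a i - L)) R
      rw [show i + 1 + k = i + (k + 1) by omega] at ht
      have hsup : ∀ S : Finset ℕ, i ∉ S → S.sup (Function.update t i (a i - L)) = S.sup t :=
        fun S hS => Finset.sup_congr rfl fun x hx =>
          Function.update_of_ne (by rintro rfl; exact hS hx) _ _
      refine ⟨Function.update t i (a i - L), fun u hu => ?_⟩
      rw [Finset.mem_Ico] at hu
      rcases hu.1.eq_or_lt with rfl | hlt
      · rw [Function.update_self, Finset.Ico_self, Finset.sup_empty, sup_bot_eq,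
          min_eq_left (hLR.trans le_sup_left)]
      · rw [Function.update_of_ne hlt.ne', ht u (Finset.mem_Ico.2 ⟨hlt, by omega⟩),
          ← Finset.insert_Ico_add_one_left_eq_Ico hlt, Finset.sup_insert, Function.update_self,
          hsup _ (by simp), hsup _ (by simp; omega), sup_assoc]
    · obtain ⟨t, ht⟩ := ih i L (R ⊔ (a (i + k) - R))
      have hsup : ∀ S : Finset ℕ, i + k ∉ S →
          S.sup (Function.update t (i + k) (a (i + k) - R)) = S.sup t :=
        fun S hS => Finset.sup_congr rfl fun x hx =>
          Function.update_of_ne (by rintro rfl; exact hS hx) _ _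
      refine ⟨Function.update t (i + k) (a (i + k) - R), fun u hu => ?_⟩
      rw [Finset.mem_Ico] at hu
      rcases (show u ≤ i + k by omega).eq_or_lt with rfl | hlt
      · rw [Function.update_self, ← add_assoc, Finset.Ico_self, Finset.sup_empty, sup_bot_eq,
          min_eq_right (hLR.trans le_sup_left)]
      · rw [Function.update_of_ne hlt.ne, ht u (Finset.mem_Ico.2 ⟨hu.1, hlt⟩), ← add_assoc,
          ← Finset.insert_Ico_right_eq_Ico_add_one (show u + 1 ≤ i + k by omega),
          Finset.sup_insert, Function.update_self,
          hsup _ (by simp; omega), hsup _ (by simp), sup_assoc]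

open scoped NNReal in
lemma exists_gapSolution (a : Fin (n + 1) → ℝ) (ha : ∀ u, 0 ≤ a u) : ∃ t, IsGapSolution a t := by
  -- The outer maxima `0` match the convention that `gap` is zero over the empty set. Truncated
  -- subtraction in `ℝ≥0` plays the role of `max 0`.
  obtain ⟨t, ht⟩ := exists_interval_solution
    (fun k => if h : k < n + 1 then (a ⟨k, h⟩).toNNReal else 0) (n + 1) 0 0 0
  refine ⟨fun u => t u, fun u => ?_⟩
  have hu := ht u (by simp only [Finset.mem_Ico]; omega)
  have hg : gap (fun u : Fin (n + 1) => (t u : ℝ)) u =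
      (min ((Finset.Ico 0 (u : ℕ)).sup t) ((Finset.Ico (u + 1 : ℕ) (n + 1)).sup t) : ℝ≥0) := by
    refine le_antisymm (gap_le (NNReal.coe_nonneg _) fun v w hv hw => ?_) ?_
    · rw [← NNReal.coe_min, NNReal.coe_le_coe]
      exact min_le_min (Finset.le_sup (by simpa using hv)) (Finset.le_sup (by simp; omega))
    · rcases (Finset.Ico 0 (u : ℕ)).eq_empty_or_nonempty with h | h
      · rw [h]
        simpa using gap_nonneg (fun _ => NNReal.coe_nonneg _) u
      rcases (Finset.Ico (u + 1 : ℕ) (n + 1)).eq_empty_or_nonempty with h' | h'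
      · rw [h']
        simpa using gap_nonneg (fun _ => NNReal.coe_nonneg _) u
      obtain ⟨v, hv, hv'⟩ := Finset.exists_mem_eq_sup _ h t
      obtain ⟨w, hw, hw'⟩ := Finset.exists_mem_eq_sup _ h' t
      rw [hv', hw']
      rw [Finset.mem_Ico] at hv hw
      exact min_le_gap (fun u : Fin (n + 1) => (t u : ℝ)) (u := u) (v := ⟨v, by omega⟩)
        (w := ⟨w, hw.2⟩) hv.2 hw.1
  simp only [zero_add, zero_le, sup_of_le_right] at hu
  rw [hg, max_comm]
  refine (congrArg NNReal.toReal hu).trans (NNReal.coe_sub_def.trans ?_)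
  rw [dif_pos u.2, Real.coe_toNNReal _ (ha _)]

/-- The pairs `(t, s)` which are coordinates of a point of the realization. -/
structure IsCoord (t s : Fin (n + 1) → ℝ) : Prop where
  nonneg (u) : 0 ≤ t u
  mem_Icc (u) : 0 ≤ s u ∧ s u ≤ 1
  eq_one (u) : 0 < t u → s u = 1
  eq_zero (u) : t u = 0 → gap t u = 0 → s u = 0

/-- Where `t u > 0`, `s u = 1` and subtracting the gap returns `t u`; where `t u = 0`, `s u ≤ 1`
makes the difference nonpositive. So `s` drops out of the equation for `t`. -/
lemma IsCoord.isGapSolution {t s : Fin (n + 1) → ℝ} (h : IsCoord t s) :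
    IsGapSolution (fun u => t u + s u * gap t u) t := by
  intro u
  have hg := gap_nonneg h.nonneg u
  rcases (h.nonneg u).eq_or_lt with e | e
  · have := mul_le_of_le_one_left hg (h.mem_Icc u).2
    rw [max_eq_left (by linarith)]
    exact e.symm
  · simp only [h.eq_one u e]
    rw [max_eq_right (by linarith)]
    ring

lemma IsCoord.unique {t s t' s' : Fin (n + 1) → ℝ} (h : IsCoord t s) (h' : IsCoord t' s')
    (e : ∀ u, t u + s u * gap t u = t' u + s' u * gap t' u) : t = t' ∧ s = s' := by
  obtain rfl : t = t' := by
    refine h.isGapSolution.unique ?_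
    rw [funext e]
    exact h'.isGapSolution
  refine ⟨rfl, funext fun u => ?_⟩
  rcases (h.nonneg u).eq_or_lt with ht | ht
  · by_cases hg : gap t u = 0
    · rw [h.eq_zero u ht.symm hg, h'.eq_zero u ht.symm hg]
    · exact mul_right_cancel₀ hg (add_left_cancel (e u))
  · rw [h.eq_one u ht, h'.eq_one u ht]

lemma exists_isCoord (a : Fin (n + 1) → ℝ) (ha : ∀ u, 0 ≤ a u) :
    ∃ t s, IsCoord t s ∧ ∀ u, t u + s u * gap t u = a u := by
  obtain ⟨t, ht⟩ := exists_gapSolution a ha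
  have hg := fun u => gap_nonneg ht.nonneg u
  have hle : ∀ u, t u = 0 → a u ≤ gap t u := fun u hu => by
    have := le_max_right 0 (a u - gap t u)
    rw [← ht u, hu] at this
    linarith
  have hgt : ∀ u, 0 < t u → t u = a u - gap t u := fun u hu => by
    have h1 := ht u
    rcases max_choice 0 (a u - gap t u) with h | h <;> rw [h] at h1
    · exact (hu.ne' h1).elim
    · exact h1
  -- Where both `t u` and the gap vanish, division by zero yields `s u = 0`, as `IsCoord.eq_zero`
  -- demands.
  refine ⟨t, fun u => if 0 < t u then 1 else a u / gap t u, ⟨ht.nonneg, fun u => ?_, fun u hu => ?_,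
    fun u hu hu' => ?_⟩, fun u => ?_⟩
  · split_ifs with hu
    · simp
    · exact ⟨div_nonneg (ha u) (hg u),
        div_le_one_of_le₀ (hle u (le_antisymm (not_lt.1 hu) (ht.nonneg u))) (hg u)⟩
  · exact if_pos hu
  · rw [if_neg (by simp [hu]), hu', div_zero]
  · dsimp only
    split_ifs with hu
    · linarith [hgt u hu]
    · have h0 := le_antisymm (not_lt.1 hu) (ht.nonneg u)
      rcases (hg u).eq_or_lt with h | h
      · rw [← h, h0, mul_zero, add_zero]
        exact le_antisymm (ha u) ((hle u h0).trans h.ge)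
      · rw [h0, div_mul_cancel₀ _ h.ne', zero_add]

lemma IsCoord.smul {t s : Fin (n + 1) → ℝ} (h : IsCoord t s) {c : ℝ} (hc : 0 < c) :
    IsCoord (fun u => c * t u) s where
  nonneg u := mul_nonneg hc.le (h.nonneg u)
  mem_Icc := h.mem_Icc
  eq_one u hu := h.eq_one u (pos_of_mul_pos_right hu hc.le)
  eq_zero u hu hg := by
    rw [gap_smul hc.le] at hg
    exact h.eq_zero u ((mul_eq_zero_iff_left hc.ne').1 (by linarith))
      ((mul_eq_zero_iff_left hc.ne').1 (by linarith))

end Gap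

/-! ### Weighted chains -/

section Mass

variable {ι κ : Type} [Fintype ι] [Fintype κ]

open Classical in
/-- The total weight of the indices with a given property. -/
def mass (A : ι → Prop) (τ : ι → ℝ) : ℝ := ∑ k, if A k then τ k else 0

lemma mass_congr {A B : ι → Prop} {τ : ι → ℝ} (h : ∀ k, A k ↔ B k) : mass A τ = mass B τ := by
  rw [show A = B from funext fun k => propext (h k)]

lemma mass_nonneg {A : ι → Prop} {τ : ι → ℝ} (h : ∀ k, A k → 0 ≤ τ k) : 0 ≤ mass A τ :=
  Finset.sum_nonneg fun k _ => by
    split_ifs with hk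
    exacts [h k hk, le_rfl]

lemma mass_eq_zero {A : ι → Prop} {τ : ι → ℝ} (h : ∀ k, ¬ A k) : mass A τ = 0 :=
  Finset.sum_eq_zero fun k _ => if_neg (h k)

lemma le_mass {A : ι → Prop} {τ : ι → ℝ} (h : ∀ k, 0 ≤ τ k) {k : ι} (hk : A k) :
    τ k ≤ mass A τ := by
  classical
  refine le_trans (by rw [if_pos hk]) (Finset.single_le_sum (f := fun k => if A k then τ k else 0)
    (fun k _ => ?_) (Finset.mem_univ k))
  split_ifs
  exacts [h k, le_rfl]

lemma mass_mono {A B : ι → Prop} {τ : ι → ℝ} (h : ∀ k, 0 ≤ τ k) (hAB : ∀ k, A k → B k) :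
    mass A τ ≤ mass B τ :=
  Finset.sum_le_sum fun k _ => by
    by_cases hA : A k
    · rw [if_pos hA, if_pos (hAB k hA)]
    · rw [if_neg hA]
      split_ifs
      exacts [h k, le_rfl]

lemma mass_true (τ : ι → ℝ) : mass (fun _ => True) τ = ∑ k, τ k := by simp [mass]

lemma mass_fiber {X : Type} [Fintype X] (α : ι → X) (τ : ι → ℝ) (A : X → Prop) :
    mass A (fun y => mass (fun k => α k = y) τ) = mass (fun k => A (α k)) τ := by
  classical
  simp only [mass]
  have : ∀ y, (if A y then ∑ k, (if α k = y then τ k else 0) else 0) =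
      ∑ k, if α k = y then (if A (α k) then τ k else 0) else 0 := by
    intro y
    split_ifs with h
    · refine Finset.sum_congr rfl fun k _ => ?_
      split_ifs with h1 h2
      · rfl
      · exact (h2 (h1 ▸ h)).elim
      · rfl
    · refine (Finset.sum_eq_zero fun k _ => ?_).symm
      split_ifs with h1 h2
      · exact (h (h1 ▸ h2)).elim
      · rfl
      · rfl
  simp only [this]
  rw [Finset.sum_comm]
  simp

lemma mass_map (f : ι → κ) (τ : stdSimplex ℝ ι) (A : κ → Prop) :
    mass A (stdSimplex.map f τ) = mass (fun k => A (f k)) τ := by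
  classical
  rw [← mass_fiber f τ A]
  congr 1
  funext y
  rw [stdSimplex.map_coe, FunOnFinite.linearMap_apply_apply, Finset.sum_filter, mass]

lemma continuous_mass (A : ι → Prop) : Continuous fun τ : stdSimplex ℝ ι => mass A τ := by
  refine continuous_finsetSum _ fun k _ => ?_
  split_ifs
  · exact (continuous_apply k).comp continuous_subtype_val
  · exact continuous_const

end Mass

/-- A strictly monotone chain with positive weights is determined by the weights of the elements. -/
lemma weighted_chain_ext {X : Type} [PartialOrder X] {p p' : ℕ} {α : Fin (p + 1) → X}
    {α' : Fin (p' + 1) → X} {τ : stdSimplex ℝ (Fin (p + 1))} {τ' : stdSimplex ℝ (Fin (p' + 1))}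
    (hα : StrictMono α) (hα' : StrictMono α') (hτ : ∀ k, 0 < τ k) (hτ' : ∀ k, 0 < τ' k)
    (h : ∀ y, mass (fun k => α k = y) τ = mass (fun k => α' k = y) τ') :
    (⟨p, α, τ⟩ : Σ p : ℕ, (Fin (p + 1) → X) × stdSimplex ℝ (Fin (p + 1))) = ⟨p', α', τ'⟩ := by
  classical
  have key : ∀ {p : ℕ} {α : Fin (p + 1) → X} {τ : stdSimplex ℝ (Fin (p + 1))},
      (∀ k, 0 < τ k) → ∀ y, y ∈ Set.range α ↔ 0 < mass (fun k => α k = y) τ := by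
    intro p α τ hτ y
    constructor
    · rintro ⟨k, rfl⟩
      exact (hτ k).trans_le (le_mass (fun k => (hτ k).le) rfl)
    · intro hy
      by_contra hy'
      exact hy.ne' (mass_eq_zero fun k hk => hy' ⟨k, hk⟩)
  have hr : Set.range α = Set.range α' := by
    ext y
    rw [key hτ, key hτ', h]
  obtain rfl : p = p' := by
    have := Set.ncard_congr' (Equiv.setCongr hr)
    rw [← Set.image_univ, ← Set.image_univ, Set.ncard_image_of_injective _ hα.injective,
      Set.ncard_image_of_injective _ hα'.injective] at this
    simpa using this
  obtain rfl : α = α' := (hα.range_inj hα').1 hr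
  have hw : ∀ (τ : stdSimplex ℝ (Fin (p + 1))) k, mass (fun j => α j = α k) τ = τ k := by
    intro τ k
    simp [mass, hα.injective.eq_iff]
  obtain rfl : τ = τ' := stdSimplex.ext (funext fun k => by rw [← hw, ← hw, h])
  rfl

/-- A weighted chain of finite sets is determined by the total weights of the sets which contain the
single elements. -/
lemma finset_chain_mass {P : Type} [Fintype P] {q q' : ℕ} {V : Fin (q + 1) → Finset P}
    {V' : Fin (q' + 1) → Finset P} {σ : Fin (q + 1) → ℝ} {σ' : Fin (q' + 1) → ℝ}
    (hV : Monotone V) (hV' : Monotone V') (hσ : ∀ l, 0 ≤ σ l) (hσ' : ∀ l, 0 ≤ σ' l)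
    (hne : ∀ l, (V l).Nonempty) (hne' : ∀ l, (V' l).Nonempty)
    (h : ∀ u, mass (fun l => u ∈ V l) σ = mass (fun l => u ∈ V' l) σ') (T : Finset P) :
    mass (fun l => V l = T) σ = mass (fun l => V' l = T) σ' := by
  classical
  -- In a chain, the element of `T` that lies in the fewest sets is the last to appear, so its
  -- presence implies that of all of `T`.
  have hmin : ∀ {q : ℕ} {V : Fin (q + 1) → Finset P} {σ : Fin (q + 1) → ℝ}, Monotone V →
      ∀ T : Finset P, T.Nonempty → ∃ u ∈ T, ∀ l, T ⊆ V l ↔ u ∈ V l := by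
    intro q V σ hV T hT
    obtain ⟨u, hu, hmin⟩ := T.exists_min_image
      (fun u => (Finset.univ.filter fun l => u ∈ V l).card) hT
    refine ⟨u, hu, fun l => ⟨fun hl => hl hu, fun hl v hv => ?_⟩⟩
    by_contra hvl
    refine (hmin v hv).not_gt (Finset.card_lt_card (Finset.ssubset_iff_subset_ne.2 ⟨fun m hm => ?_,
      fun e => ?_⟩))
    · simp only [Finset.mem_filter, Finset.mem_univ, true_and] at hm ⊢
      rcases le_total l m with hlm | hlm
      · exact hV hlm hl
      · exact (hvl (hV hlm hm)).elim
    · have : l ∈ Finset.univ.filter fun l => v ∈ V l := by simpa [e] using hl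
      exact hvl (by simpa using this)
  have hG : ∀ T : Finset P, T.Nonempty →
      mass (fun l => T ⊆ V l) σ = mass (fun l => T ⊆ V' l) σ' := by
    intro T hT
    obtain ⟨u, hu, h1⟩ := hmin (σ := σ) hV T hT
    obtain ⟨u', hu', h2⟩ := hmin (σ := σ') hV' T hT
    refine le_antisymm ?_ ?_
    · rw [mass_congr h2, ← h u']
      exact mass_mono hσ fun l hl => hl hu'
    · rw [mass_congr h1, h u]
      exact mass_mono hσ' fun l hl => hl hu
  -- Total weights of supersets now agree. At a largest set with differing weights all proper
  -- supersets cancel, a contradiction; the empty set does not occur in the chains.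
  by_contra hT
  obtain ⟨S, hS, hmax⟩ := (Finset.univ.filter fun T => mass (fun l => V l = T) σ ≠
    mass (fun l => V' l = T) σ').exists_max_image Finset.card ⟨T, by simpa using hT⟩
  simp only [Finset.mem_filter, Finset.mem_univ, true_and] at hS hmax
  refine hS ?_
  rcases S.eq_empty_or_nonempty with rfl | hne
  · rw [mass_eq_zero fun l e => (hne l).ne_empty e, mass_eq_zero fun l e => (hne' l).ne_empty e]
  have e := hG S hne
  rw [← mass_fiber V σ (fun T => S ⊆ T), ← mass_fiber V' σ' (fun T => S ⊆ T)] at e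
  simp only [mass] at e
  rw [← Finset.add_sum_erase _ _ (Finset.mem_univ S),
    ← Finset.add_sum_erase _ _ (Finset.mem_univ S),
    if_pos (Finset.Subset.refl S), if_pos (Finset.Subset.refl S)] at e
  refine (add_left_inj _).1 (e.trans (congrArg _ (Finset.sum_congr rfl fun T hT => ?_).symm))
  split_ifs with hST
  · by_contra hne'
    exact (hmax T hne').not_gt (Finset.card_lt_card
      (Finset.ssubset_iff_subset_ne.2 ⟨hST, (Finset.ne_of_mem_erase hT).symm⟩))
  · rfl

/-! ### The comparison map -/

section Comparison

variable {n p q : ℕ}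

/-- The coordinates `t` of a point of a cell. -/
def objMass (x : BarSimplex (SimplexCategory.toCat.obj (SimplexCategory.mk n)) p q)
    (τ : stdSimplex ℝ (Fin (p + 1))) (u : Fin (n + 1)) : ℝ :=
  mass (fun k => labels (idLabel n) x k = u) τ

/-- The coordinates `s` of a point of a cell. -/
def passMass (x : BarSimplex (SimplexCategory.toCat.obj (SimplexCategory.mk n)) p q)
    (σ : stdSimplex ℝ (Fin (q + 1))) (u : Fin (n + 1)) : ℝ :=
  mass (fun l => u ∈ vsets (idLabel n) x l) σ

variable (x : BarSimplex (SimplexCategory.toCat.obj (SimplexCategory.mk n)) p q)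
  (τ : stdSimplex ℝ (Fin (p + 1))) (σ : stdSimplex ℝ (Fin (q + 1)))

lemma objWeight_eq : objWeight (C := SimplexCategory.toCat.obj (SimplexCategory.mk n)) x τ =
    objMass x τ :=
  funext fun u => mass_congr fun k => label_eq_iff (isOrderLabel_idLabel n) x k u

lemma passWeight_eq : passWeight (C := SimplexCategory.toCat.obj (SimplexCategory.mk n)) x σ =
    passMass x σ :=
  funext fun u => mass_congr fun l => passes_iff (isOrderLabel_idLabel n) x l u

lemma unnormalized_eq (u : Fin (n + 1)) :
    unnormalized x τ σ u = objMass x τ u + passMass x σ u * gap (objMass x τ) u := by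
  rw [unnormalized, objWeight_eq, passWeight_eq]
  rfl

lemma objMass_nonneg (u : Fin (n + 1)) : 0 ≤ objMass x τ u :=
  mass_nonneg fun k _ => stdSimplex.zero_le τ k

lemma passMass_nonneg (u : Fin (n + 1)) : 0 ≤ passMass x σ u :=
  mass_nonneg fun k _ => stdSimplex.zero_le σ k

lemma passMass_le_one (u : Fin (n + 1)) : passMass x σ u ≤ 1 := by
  refine (mass_mono (fun l => stdSimplex.zero_le σ l) fun _ _ => trivial).trans_eq
    ((mass_true _).trans (stdSimplex.sum_eq_one σ))

lemma sum_objMass : ∑ u, objMass x τ u = 1 := by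
  rw [← mass_true]
  refine (mass_fiber (labels (idLabel n) x) τ fun _ => True).trans ?_
  rw [mass_true]
  exact stdSimplex.sum_eq_one τ

lemma unnormalized_nonneg (u : Fin (n + 1)) : 0 ≤ unnormalized x τ σ u := by
  rw [unnormalized_eq]
  exact add_nonneg (objMass_nonneg x τ u)
    (mul_nonneg (passMass_nonneg x σ u) (gap_nonneg (objMass_nonneg x τ) u))

lemma sum_unnormalized_pos : 0 < ∑ u, unnormalized x τ σ u := by
  refine lt_of_lt_of_le ?_ (Finset.sum_le_sum (f := objMass x τ) fun u _ => ?_)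
  · rw [sum_objMass]
    exact one_pos
  · rw [unnormalized_eq]
    exact le_add_of_nonneg_right
      (mul_nonneg (passMass_nonneg x σ u) (gap_nonneg (objMass_nonneg x τ) u))

/-- The point of the simplex given by the normalized coordinates. -/
def barPoint : stdSimplex ℝ (Fin (n + 1)) :=
  ⟨fun u => unnormalized x τ σ u / ∑ v, unnormalized x τ σ v,
    fun u => div_nonneg (unnormalized_nonneg x τ σ u) (sum_unnormalized_pos x τ σ).le, by
      rw [← Finset.sum_div, div_self (sum_unnormalized_pos x τ σ).ne']⟩

variable {x τ σ}

lemma exists_label_of_objMass_pos {u : Fin (n + 1)} (h : 0 < objMass x τ u) :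
    ∃ k, labels (idLabel n) x k = u ∧ 0 < τ k := by
  by_contra! H
  refine h.not_ge ?_
  rw [← neg_nonneg, objMass, mass, ← Finset.sum_neg_distrib]
  refine Finset.sum_nonneg fun k _ => ?_
  split_ifs with hk
  · exact neg_nonneg.2 (H k hk)
  · simp

lemma labels_of_gap_ne {u : Fin (n + 1)} (h : gap (objMass x τ) u ≠ 0) :
    ∃ i j, labels (idLabel n) x i < u ∧ u < labels (idLabel n) x j ∧ 0 < τ i ∧ 0 < τ j := by
  obtain ⟨v, w, hv, hw, h1, h2⟩ := exists_of_lt_gap le_rfl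
    (lt_of_le_of_ne (gap_nonneg (objMass_nonneg x τ) u) h.symm)
  obtain ⟨i, rfl, hi⟩ := exists_label_of_objMass_pos h1
  obtain ⟨j, rfl, hj⟩ := exists_label_of_objMass_pos h2
  exact ⟨i, j, hv, hw, hi, hj⟩

variable {p' q' : ℕ} {x' : BarSimplex (SimplexCategory.toCat.obj (SimplexCategory.mk n)) p' q'}
  {τ' : stdSimplex ℝ (Fin (p' + 1))} {σ' : stdSimplex ℝ (Fin (q' + 1))}

lemma barPoint_eq_of_unnormalized (h : ∀ u, unnormalized x τ σ u = unnormalized x' τ' σ' u) :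
    barPoint x τ σ = barPoint x' τ' σ' := by
  apply Subtype.ext
  funext u
  simp only [barPoint, h]

/-- The comparison map on cells. -/
def cellPoint (n : ℕ) (z : BarCells (SimplexCategory.toCat.obj (SimplexCategory.mk n))) :
    stdSimplex ℝ (Fin (n + 1)) :=
  barPoint z.1.2.2 z.2.1 z.2.2

lemma cellPoint_rel (n : ℕ) (y z : BarCells (SimplexCategory.toCat.obj (SimplexCategory.mk n)))
    (h : BarRel _ y z) : cellPoint n y = cellPoint n z := by
  cases h with
  | @bar p p' q θ x τ σ =>
    refine barPoint_eq_of_unnormalized fun u => ?_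
    change unnormalized (((bar q).obj _).map θ.op x) τ σ u =
      unnormalized x (stdSimplex.map θ τ) σ u
    rw [unnormalized_eq, unnormalized_eq]
    have ht : objMass (((bar q).obj _).map θ.op x) τ = objMass x (stdSimplex.map θ τ) :=
      funext fun v => (mass_map θ τ fun k => labels (idLabel n) x k = v).symm
    rw [← ht]
    -- The operator cuts the vertex sets to an interval, which may change `s u`. A nonzero gap
    -- places `u` strictly between two labels of the new string, hence inside that interval.
    by_cases hg : gap (objMass (((bar q).obj _).map θ.op x) τ) u = 0
    · rw [hg, mul_zero, mul_zero]
    · obtain ⟨i, j, hi, hj, -, -⟩ := labels_of_gap_ne hg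
      have hi' := (labels_monotone (π := idLabel n) (((bar q).obj _).map θ.op x)
        (Fin.zero_le i)).trans hi.le
      have hj' := hj.le.trans (labels_monotone (π := idLabel n) (((bar q).obj _).map θ.op x)
        (Fin.le_last j))
      congr 2
      refine mass_congr fun l => ?_
      rw [vsets_bar, Finset.mem_filter]
      exact ⟨fun h => h.1, fun h => ⟨h, hi', hj'⟩⟩
  | face i x τ σ =>
    refine barPoint_eq_of_unnormalized fun u => ?_
    change unnormalized (barFace i x) τ σ u =
      unnormalized x τ (stdSimplex.map (SimplexCategory.δ i) σ) u
    rw [unnormalized_eq, unnormalized_eq]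
    have ht : objMass (barFace i x) τ = objMass x τ := by
      funext v
      rw [objMass, labels_barFace]
      rfl
    have hs : passMass (barFace i x) σ u =
        passMass x (stdSimplex.map (SimplexCategory.δ i) σ) u := by
      rw [passMass, vsets_barFace, passMass, mass_map]
      rfl
    rw [ht, hs]
  | degen i x τ σ =>
    refine barPoint_eq_of_unnormalized fun u => ?_
    change unnormalized (barDegen i x) τ σ u =
      unnormalized x τ (stdSimplex.map (SimplexCategory.σ i) σ) u
    rw [unnormalized_eq, unnormalized_eq]
    have ht : objMass (barDegen i x) τ = objMass x τ := by
      funext v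
      rw [objMass, labels_barDegen]
      rfl
    have hs : passMass (barDegen i x) σ u =
        passMass x (stdSimplex.map (SimplexCategory.σ i) σ) u := by
      rw [passMass, vsets_barDegen, passMass, mass_map]
      rfl
    rw [ht, hs]

lemma continuous_cellPoint (n : ℕ) : Continuous (cellPoint n) := by
  refine continuous_sigma fun x => ?_
  have h : ∀ u, Continuous fun y : stdSimplex ℝ (Fin (x.1 + 1)) × stdSimplex ℝ (Fin (x.2.1 + 1)) =>
      unnormalized x.2.2 y.1 y.2 u := by
    intro u
    simp only [unnormalized_eq]
    have ht : ∀ v, Continuous fun y : stdSimplex ℝ (Fin (x.1 + 1)) ×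
        stdSimplex ℝ (Fin (x.2.1 + 1)) => objMass x.2.2 y.1 v := fun v =>
      (continuous_mass _).comp continuous_fst
    exact (ht u).add (((continuous_mass _).comp continuous_snd).mul
      ((continuous_gap u).comp (continuous_pi ht)))
  exact Continuous.subtype_mk (continuous_pi fun u => (h u).div
    (continuous_finsetSum _ fun v _ => h v) fun y => (sum_unnormalized_pos _ _ _).ne') _

/-! ### Nondegenerate points -/

/-- Points in the interior of nondegenerate cells. -/
structure IsReduced (x : BarSimplex (SimplexCategory.toCat.obj (SimplexCategory.mk n)) p q)
    (τ : stdSimplex ℝ (Fin (p + 1))) (σ : stdSimplex ℝ (Fin (q + 1))) : Prop where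
  labels : StrictMono (labels (idLabel n) x)
  vsets : StrictMono (vsets (idLabel n) x)
  pos (k) : 0 < τ k
  pos' (l) : 0 < σ l

/-- Labels belong to every vertex set, which gives `s = 1` on the support of `t`. An object in some
vertex set lies between the first and last label; both have positive weight, so if it is not itself
a label its gap is positive. -/
lemma IsReduced.isCoord (h : IsReduced x τ σ) : IsCoord (objMass x τ) (passMass x σ) where
  nonneg := objMass_nonneg x τ
  mem_Icc u := ⟨passMass_nonneg x σ u, passMass_le_one x σ u⟩
  eq_one u hu := by
    obtain ⟨k, rfl, -⟩ := exists_label_of_objMass_pos hu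
    refine (mass_congr (B := fun _ => True) fun l => iff_true_intro (labels_mem_vsets x k l)).trans
      ((mass_true _).trans (stdSimplex.sum_eq_one σ))
  eq_zero u hu hg := by
    have hp : ∀ k, 0 < objMass x τ (FreeBar.labels (idLabel n) x k) := fun k =>
      (h.pos k).trans_le (le_mass (fun k => (h.pos k).le) rfl)
    refine mass_eq_zero fun l hl => ?_
    obtain ⟨h0, h1⟩ := le_of_mem_vsets hl
    have h0' := h0.lt_of_ne (by rintro rfl; exact (hp _).ne' hu)
    have h1' := h1.lt_of_ne (by rintro rfl; exact (hp _).ne' hu)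
    exact (lt_of_lt_of_le (lt_min (hp _) (hp _)) (min_le_gap (objMass x τ) h0' h1')).ne' hg

lemma IsReduced.cell_eq (h : IsReduced x τ σ) (h' : IsReduced x' τ' σ')
    (e : objMass x τ = objMass x' τ') (e' : passMass x σ = passMass x' σ') :
    cell x τ σ = cell x' τ' σ' := by
  have hp := weighted_chain_ext h.labels h'.labels h.pos h'.pos (congrFun e)
  have hq := weighted_chain_ext h.vsets h'.vsets h.pos' h'.pos' (finset_chain_mass
    h.vsets.monotone h'.vsets.monotone (stdSimplex.zero_le σ) (stdSimplex.zero_le σ')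
    (fun l => ⟨_, labels_mem_vsets x 0 l⟩) (fun l => ⟨_, labels_mem_vsets x' 0 l⟩) (congrFun e'))
  obtain rfl : p = p' := congrArg Sigma.fst hp
  obtain rfl : q = q' := congrArg Sigma.fst hq
  simp only [Sigma.mk.injEq, heq_eq_eq, true_and, Prod.mk.injEq] at hp hq
  obtain ⟨hp, rfl⟩ := hp
  obtain ⟨hq, rfl⟩ := hq
  obtain rfl : x = x' := string_ext (isOrderLabel_idLabel n) hp hq
  rfl

/-- Equal normalized coordinates make the unnormalized ones proportional. By homogeneity and
uniqueness `t = c t'`, and both sum to `1`, so `c = 1`. -/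
lemma IsReduced.cell_eq_of_barPoint_eq (h : IsReduced x τ σ) (h' : IsReduced x' τ' σ')
    (e : barPoint x τ σ = barPoint x' τ' σ') : cell x τ σ = cell x' τ' σ' := by
  have hS := sum_unnormalized_pos x τ σ
  have hS' := sum_unnormalized_pos x' τ' σ'
  set c := (∑ v, unnormalized x τ σ v) / ∑ v, unnormalized x' τ' σ' v with hc
  have hc0 : 0 < c := div_pos hS hS'
  have he : ∀ u, unnormalized x τ σ u = c * unnormalized x' τ' σ' u := by
    intro u
    have := congrFun (congrArg Subtype.val e) u
    simp only [barPoint] at this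
    rw [div_eq_div_iff hS.ne' hS'.ne'] at this
    rw [hc, div_mul_eq_mul_div, eq_div_iff hS'.ne', this, mul_comm]
  obtain ⟨e1, e2⟩ := h.isCoord.unique (h'.isCoord.smul hc0) fun u => by
    rw [gap_smul hc0.le, ← unnormalized_eq, he, unnormalized_eq]
    ring
  have hc1 : c = 1 := by
    have := sum_objMass x τ
    rw [e1, ← Finset.mul_sum, sum_objMass, mul_one] at this
    exact this
  refine h.cell_eq h' ?_ e2
  rw [e1]
  simp [hc1]

end Comparison

/-! ### Reduction of points to interiors of nondegenerate cells -/

section Reduction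

variable {n p q : ℕ}

/-- A point of a simplex with a vanishing coordinate lies in a face. -/
lemma exists_map_succAbove (k : Fin (p + 2)) (τ : stdSimplex ℝ (Fin (p + 2))) (h : τ k = 0) :
    ∃ τ' : stdSimplex ℝ (Fin (p + 1)), stdSimplex.map k.succAbove τ' = τ := by
  have hsum : ∑ j, τ (k.succAbove j) = 1 := by
    have := stdSimplex.sum_eq_one τ
    rwa [Fin.sum_univ_succAbove _ k, h, zero_add] at this
  refine ⟨⟨fun j => τ (k.succAbove j), fun j => stdSimplex.zero_le τ _, hsum⟩, ?_⟩
  refine stdSimplex.ext (funext fun i => ?_)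
  rw [stdSimplex.map_coe, FunOnFinite.linearMap_apply_apply, Finset.sum_filter]
  induction i using Fin.succAboveCases k with
  | x =>
    rw [h]
    exact Finset.sum_eq_zero fun j _ => if_neg (Fin.succAbove_ne k j)
  | p i =>
    simp only [Fin.succAbove_right_inj]
    rw [Finset.sum_ite_eq' Finset.univ i, if_pos (Finset.mem_univ i)]
    rfl

/-- A point of the zero-dimensional simplex has a nonzero coordinate. -/
lemma exists_succ_of_zero {k : Fin (p + 1)} {τ : stdSimplex ℝ (Fin (p + 1))} (h : τ k = 0) :
    ∃ p', p = p' + 1 := by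
  cases p with
  | zero =>
    have := stdSimplex.eq_one_of_unique (X := Fin 1) τ k
    exact absurd (h.symm.trans this) zero_ne_one
  | succ p => exact ⟨p, rfl⟩

variable (x : BarSimplex (SimplexCategory.toCat.obj (SimplexCategory.mk n)) p q)
  (τ : stdSimplex ℝ (Fin (p + 1))) (σ : stdSimplex ℝ (Fin (q + 1)))

/-- The class of a point of a cell. -/
abbrev barMk : BarSpace (SimplexCategory.toCat.obj (SimplexCategory.mk n)) :=
  Quot.mk _ (cell x τ σ)

lemma exists_smaller_of_weight_zero {k : Fin (p + 1)} (h : τ k = 0) :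
    ∃ (p' : ℕ) (x' : BarSimplex (SimplexCategory.toCat.obj (SimplexCategory.mk n)) p' q)
      (τ' : stdSimplex ℝ (Fin (p' + 1))), p' < p ∧ barMk x' τ' σ = barMk x τ σ := by
  obtain ⟨p, rfl⟩ := exists_succ_of_zero h
  obtain ⟨τ', rfl⟩ := exists_map_succAbove k τ h
  exact ⟨p, _, τ', Nat.lt_succ_self p, Quot.sound (BarRel.bar (SimplexCategory.δ k) x τ' σ)⟩

lemma exists_smaller_of_weight_zero' {l : Fin (q + 1)} (h : σ l = 0) :
    ∃ (q' : ℕ) (x' : BarSimplex (SimplexCategory.toCat.obj (SimplexCategory.mk n)) p q')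
      (σ' : stdSimplex ℝ (Fin (q' + 1))), q' < q ∧ barMk x' τ σ' = barMk x τ σ := by
  obtain ⟨q, rfl⟩ := exists_succ_of_zero h
  obtain ⟨σ', rfl⟩ := exists_map_succAbove l σ h
  exact ⟨q, _, σ', Nat.lt_succ_self q, Quot.sound (BarRel.face l x τ σ')⟩

/-- Dropping and reinserting an index changes only that index, where its successor is substituted.
This recognizes degenerate simplices by a repetition in their data. -/
lemma comp_succAbove_predAbove {X : Type} (f : Fin (p + 2) → X) (k : Fin (p + 1))
    (h : f k.castSucc = f k.succ) (j : Fin (p + 2)) :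
    f (k.castSucc.succAbove (k.predAbove j)) = f j := by
  by_cases hj : j = k.castSucc
  · rw [hj, Fin.predAbove_castSucc_self, Fin.succAbove_castSucc_self, h]
  · rw [Fin.succAbove_predAbove hj]

lemma exists_smaller_of_labels (h : ¬ StrictMono (labels (idLabel n) x)) :
    ∃ (p' : ℕ) (x' : BarSimplex (SimplexCategory.toCat.obj (SimplexCategory.mk n)) p' q)
      (τ' : stdSimplex ℝ (Fin (p' + 1))), p' < p ∧ barMk x' τ' σ = barMk x τ σ := by
  rw [Fin.strictMono_iff_lt_succ] at h
  push Not at h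
  obtain ⟨k, hk⟩ := h
  obtain ⟨p, rfl⟩ : ∃ p', p = p' + 1 := by
    cases p with
    | zero => exact Fin.elim0 k
    | succ p => exact ⟨p, rfl⟩
  have e := (labels_monotone (π := idLabel n) x (Fin.castSucc_le_succ k)).antisymm hk
  have hx : ((bar q).obj _).map (SimplexCategory.σ k).op
      (((bar q).obj _).map (SimplexCategory.δ k.castSucc).op x) = x := by
    have hl : labels (idLabel n) (((bar q).obj _).map (SimplexCategory.σ k).op
      (((bar q).obj _).map (SimplexCategory.δ k.castSucc).op x)) = labels (idLabel n) x :=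
      funext fun j => comp_succAbove_predAbove (labels (idLabel n) x) k e j
    refine string_ext (isOrderLabel_idLabel n) hl (funext fun l => ?_)
    rw [vsets_bar, vsets_bar, Finset.filter_filter]
    -- The end labels are unchanged, so cutting to the new intervals removes nothing.
    refine Finset.filter_true_of_mem fun u hu => ?_
    obtain ⟨h0, h1⟩ := le_of_mem_vsets hu
    have e0 : labels (idLabel n) x (SimplexCategory.δ k.castSucc (SimplexCategory.σ k 0)) =
      labels (idLabel n) x 0 := congrFun hl 0
    have e1 : labels (idLabel n) x (SimplexCategory.δ k.castSucc
      (SimplexCategory.σ k (Fin.last (p + 1)))) = labels (idLabel n) x (Fin.last (p + 1)) :=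
      congrFun hl _
    have m0 : labels (idLabel n) x (SimplexCategory.δ k.castSucc 0) ≤
        labels (idLabel n) x (SimplexCategory.δ k.castSucc (SimplexCategory.σ k 0)) :=
      labels_monotone (π := idLabel n) (((bar q).obj _).map (SimplexCategory.δ k.castSucc).op x)
        (Fin.zero_le _)
    have m1 : labels (idLabel n) x (SimplexCategory.δ k.castSucc
        (SimplexCategory.σ k (Fin.last (p + 1)))) ≤
        labels (idLabel n) x (SimplexCategory.δ k.castSucc (Fin.last p)) :=
      labels_monotone (π := idLabel n) (((bar q).obj _).map (SimplexCategory.δ k.castSucc).op x)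
        (Fin.le_last _)
    exact ⟨⟨(m0.trans e0.le).trans h0, h1.trans (e1.ge.trans m1)⟩, e0.le.trans h0, h1.trans e1.ge⟩
  refine ⟨p, ((bar q).obj _).map (SimplexCategory.δ k.castSucc).op x,
    stdSimplex.map (SimplexCategory.σ k) τ, Nat.lt_succ_self p, ?_⟩
  have r := Quot.sound (BarRel.bar (SimplexCategory.σ k)
    (((bar q).obj _).map (SimplexCategory.δ k.castSucc).op x) τ σ)
  rw [hx] at r
  exact r.symm

lemma exists_smaller_of_vsets (h : ¬ StrictMono (vsets (idLabel n) x)) :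
    ∃ (q' : ℕ) (x' : BarSimplex (SimplexCategory.toCat.obj (SimplexCategory.mk n)) p q')
      (σ' : stdSimplex ℝ (Fin (q' + 1))), q' < q ∧ barMk x' τ σ' = barMk x τ σ := by
  rw [Fin.strictMono_iff_lt_succ] at h
  push Not at h
  obtain ⟨l, hl⟩ := h
  obtain ⟨q, rfl⟩ : ∃ q', q = q' + 1 := by
    cases q with
    | zero => exact Fin.elim0 l
    | succ q => exact ⟨q, rfl⟩
  have hle := vsets_monotone (π := idLabel n) x (Fin.castSucc_le_succ l)
  have e : vsets (idLabel n) x l.castSucc = vsets (idLabel n) x l.succ :=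
    hle.eq_or_lt.resolve_right hl
  have hx : barDegen l (barFace l.castSucc x) = x := by
    refine string_ext (isOrderLabel_idLabel n) ?_ ?_
    · rw [labels_barDegen, labels_barFace]
    · rw [vsets_barDegen, vsets_barFace]
      exact funext fun j => comp_succAbove_predAbove (vsets (idLabel n) x) l e j
  refine ⟨q, barFace l.castSucc x, stdSimplex.map (SimplexCategory.σ l) σ, Nat.lt_succ_self q, ?_⟩
  have r := Quot.sound (BarRel.degen l (barFace l.castSucc x) τ σ)
  rw [hx] at r
  exact r.symm

/-- Every point of the realization lies in the interior of a nondegenerate cell. -/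
lemma exists_isReduced : ∃ (p' q' : ℕ)
    (x' : BarSimplex (SimplexCategory.toCat.obj (SimplexCategory.mk n)) p' q')
    (τ' : stdSimplex ℝ (Fin (p' + 1))) (σ' : stdSimplex ℝ (Fin (q' + 1))),
    IsReduced x' τ' σ' ∧ barMk x' τ' σ' = barMk x τ σ := by
  induction hm : p + q using Nat.strong_induction_on generalizing p q with
  | _ m ih =>
  subst hm
  by_cases h : IsReduced x τ σ
  · exact ⟨p, q, x, τ, σ, h, rfl⟩
  · by_cases h1 : StrictMono (labels (idLabel n) x)
    · by_cases h2 : StrictMono (vsets (idLabel n) x)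
      · by_cases h3 : ∀ k, 0 < τ k
        · by_cases h4 : ∀ l, 0 < σ l
          · exact (h ⟨h1, h2, h3, h4⟩).elim
          · push Not at h4
            obtain ⟨l, hl⟩ := h4
            obtain ⟨q', x', σ', hq, e⟩ := exists_smaller_of_weight_zero' x τ σ
              (hl.antisymm (stdSimplex.zero_le σ l))
            rw [← e]
            exact ih _ (by omega) x' τ σ' rfl
        · push Not at h3
          obtain ⟨k, hk⟩ := h3
          obtain ⟨p', x', τ', hp, e⟩ := exists_smaller_of_weight_zero x τ σ
            (hk.antisymm (stdSimplex.zero_le τ k))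
          rw [← e]
          exact ih _ (by omega) x' τ' σ rfl
      · obtain ⟨q', x', σ', hq, e⟩ := exists_smaller_of_vsets x τ σ h2
        rw [← e]
        exact ih _ (by omega) x' τ σ' rfl
    · obtain ⟨p', x', τ', hp, e⟩ := exists_smaller_of_labels x τ σ h1
      rw [← e]
      exact ih _ (by omega) x' τ' σ rfl

end Reduction

/-! ### Surjectivity -/

open Classical in
lemma mass_succ {q : ℕ} (A : Fin (q + 2) → Prop) (σ : Fin (q + 2) → ℝ) :
    mass A σ =
      (if A 0 then σ 0 else 0) + mass (fun l : Fin (q + 1) => A l.succ) (fun l => σ l.succ) :=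
  Fin.sum_univ_succ _

/-- The chain of superlevel sets of a function, weighted by the differences of its values. -/
lemma exists_level_chain {P : Type} [Fintype P] (c : ℝ) (hc : 0 < c) (s : P → ℝ)
    (hs : ∀ u, 0 ≤ s u ∧ s u ≤ c) : ∃ (q : ℕ) (V : Fin (q + 1) → Finset P) (σ : Fin (q + 1) → ℝ),
      Monotone V ∧ (∀ l, 0 ≤ σ l) ∧ ∑ l, σ l = c ∧ (∀ l u, s u = c → u ∈ V l) ∧
      (∀ l, ∀ u ∈ V l, 0 < s u) ∧ ∀ u, mass (fun l => u ∈ V l) σ = s u := by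
  classical
  induction hm : (Finset.univ.filter fun u => 0 < s u ∧ s u < c).card using
    Nat.strong_induction_on generalizing c s with
  | _ m ih =>
  subst hm
  rcases (Finset.univ.filter fun u => 0 < s u ∧ s u < c).eq_empty_or_nonempty with h | h
  · have h' : ∀ u, 0 < s u → s u = c := fun u hu => by
      by_contra hne
      have : u ∈ Finset.univ.filter fun u => 0 < s u ∧ s u < c := by
        simpa using ⟨hu, (hs u).2.lt_of_ne hne⟩
      simp [h] at this
    refine ⟨0, fun _ => Finset.univ.filter fun u => s u = c, fun _ => c, fun _ _ _ => le_rfl,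
      fun _ => hc.le, by simp, fun _ u hu => by simpa using hu, fun _ u hu => ?_, fun u => ?_⟩
    · rw [Finset.mem_filter] at hu
      rw [hu.2]
      exact hc
    · simp only [mass, Finset.mem_filter, Finset.mem_univ, true_and]
      split_ifs with hu
      · simpa using hu.symm
      · simpa using le_antisymm (hs u).1 (not_lt.1 fun h0 => hu (h' u h0))
  -- With `s v` the largest value strictly between `0` and `c`, the layer `s = c` gets weight `c - s
  -- v`. Truncating `s` at `s v` leaves fewer intermediate elements.
  · obtain ⟨v, hv, hmax⟩ := Finset.exists_max_image _ s h
    simp only [Finset.mem_filter, Finset.mem_univ, true_and] at hv hmax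
    have hcase : ∀ u, s u = c ∨ s u ≤ s v := fun u => by
      rcases (hs u).2.eq_or_lt with h | h
      · exact .inl h
      · rcases (hs u).1.eq_or_lt with h0 | h0
        · exact .inr (h0 ▸ hv.1.le)
        · exact .inr (hmax u ⟨h0, h⟩)
    obtain ⟨q, V, σ, hV, hσ, hsum, h1, h2, h3⟩ := ih _ (Finset.card_lt_card (by
      refine Finset.ssubset_iff_of_subset (fun u hu => ?_) |>.2 ⟨v, by simpa using hv, by simp⟩
      simp only [Finset.mem_filter, Finset.mem_univ, true_and, lt_min_iff, min_lt_iff,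
        lt_self_iff_false, or_false] at hu ⊢
      exact ⟨hu.1.1, hu.2.trans hv.2⟩)) (s v) hv.1 (fun u => min (s u) (s v))
      (fun u => ⟨le_min (hs u).1 hv.1.le, min_le_right _ _⟩) rfl
    refine ⟨q + 1, Fin.cons (Finset.univ.filter fun u => s u = c) V, Fin.cons (c - s v) σ,
      ?_, ?_, ?_, ?_, ?_, ?_⟩
    · refine Fin.monotone_iff_le_succ.2 fun l => ?_
      induction l using Fin.cases with
      | zero =>
        intro u hu
        have hu' : s u = c := by simpa using hu
        exact h1 0 u (by rw [hu', min_eq_right hv.2.le])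
      | succ l => exact hV (Fin.castSucc_le_succ l)
    · intro l
      induction l using Fin.cases with
      | zero => exact sub_nonneg.2 hv.2.le
      | succ l => exact hσ l
    · rw [Fin.sum_univ_succ]
      simp [hsum]
    · intro l u hu
      induction l using Fin.cases with
      | zero => simpa using hu
      | succ l => exact h1 l u (by rw [hu, min_eq_right hv.2.le])
    · intro l u hu
      induction l using Fin.cases with
      | zero =>
        have hu' : s u = c := by simpa using hu
        rw [hu']
        exact hc
      | succ l => exact (lt_min_iff.1 (h2 l u hu)).1
    · intro u
      rw [mass_succ]
      simp only [Fin.cons_zero, Fin.cons_succ, h3 u, Finset.mem_filter, Finset.mem_univ, true_and]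
      split_ifs with hu
      · rw [hu, min_eq_right hv.2.le]
        ring
      · rw [min_eq_left ((hcase u).resolve_left hu), zero_add]

/-- Every pair of coordinates comes from a point of a cell. -/
lemma exists_cell {n : ℕ} {t s : Fin (n + 1) → ℝ} (h : IsCoord t s) (ht : ∑ u, t u = 1) :
    ∃ (p q : ℕ) (x : BarSimplex (SimplexCategory.toCat.obj (SimplexCategory.mk n)) p q)
      (τ : stdSimplex ℝ (Fin (p + 1))) (σ : stdSimplex ℝ (Fin (q + 1))),
      objMass x τ = t ∧ passMass x σ = s := by
  classical
  set A := Finset.univ.filter fun u => 0 < t u with hA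
  have hmem : ∀ u, u ∈ A ↔ 0 < t u := fun u => by simp [hA]
  have hne : A.Nonempty := by
    by_contra hA'
    rw [Finset.not_nonempty_iff_eq_empty] at hA'
    refine zero_ne_one (α := ℝ) ?_
    rw [← ht, eq_comm]
    refine Finset.sum_eq_zero fun u _ => le_antisymm (not_lt.1 fun hu => ?_) (h.nonneg u)
    rw [← hmem, hA'] at hu
    simp at hu
  obtain ⟨p, hp⟩ : ∃ p, A.card = p + 1 := ⟨A.card - 1, by have := hne.card_pos; omega⟩
  set α := A.orderEmbOfFin hp with hα
  have hαA : ∀ k, 0 < t (α k) := fun k => (hmem _).1 (A.orderEmbOfFin_mem hp k)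
  have hsurj : ∀ u, 0 < t u → ∃ k, α k = u := fun u hu => by
    have : u ∈ Set.range α := by
      rw [hα, Finset.range_orderEmbOfFin]
      exact (hmem u).2 hu
    exact this
  have hmass : ∀ u, mass (fun k => α k = u) (fun k => t (α k)) = t u := by
    intro u
    by_cases hu : 0 < t u
    · obtain ⟨k, rfl⟩ := hsurj u hu
      simp [mass]
    · rw [mass_eq_zero fun k hk => hu (by rw [← hk]; exact hαA k)]
      exact (le_antisymm (not_lt.1 hu) (h.nonneg u)).symm
  have hsum : ∑ k, t (α k) = 1 := by
    rw [← mass_true, ← mass_fiber α _ fun _ => True, mass_true, ← ht]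
    exact Finset.sum_congr rfl fun u _ => hmass u
  obtain ⟨q, V, σ, hV, hσ, hσsum, h1, h2, h3⟩ := exists_level_chain 1 one_pos s h.mem_Icc
  -- The sequence `α` enumerates the support of `t`, where `s = 1`, so it lies in `V 0`. Elements of
  -- `V l` have `s > 0`, hence positive `t` or positive gap; either puts them between the first and
  -- last `α`.
  obtain ⟨x, hx1, hx2⟩ := exists_string (C := SimplexCategory.toCat.obj (SimplexCategory.mk n))
    (isOrderLabel_idLabel n) (q := q) α α.monotone V hV
    (fun k => h1 0 _ (h.eq_one _ (hαA k))) (fun l u hu => by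
      have hs := h2 l u hu
      rcases (h.nonneg u).eq_or_lt with h0 | h0
      · have hg : gap t u ≠ 0 := fun hg => hs.ne' (h.eq_zero u h0.symm hg)
        obtain ⟨v, w, hv, hw, hv', hw'⟩ := exists_of_lt_gap le_rfl
          (lt_of_le_of_ne (gap_nonneg h.nonneg u) hg.symm)
        obtain ⟨i, rfl⟩ := hsurj v hv'
        obtain ⟨j, rfl⟩ := hsurj w hw'
        exact ⟨(α.monotone (Fin.zero_le i)).trans hv.le, hw.le.trans (α.monotone (Fin.le_last j))⟩
      · obtain ⟨k, rfl⟩ := hsurj u h0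
        exact ⟨α.monotone (Fin.zero_le k), α.monotone (Fin.le_last k)⟩)
  refine ⟨p, q, x, ⟨fun k => t (α k), fun k => (hαA k).le, hsum⟩, ⟨σ, hσ, hσsum⟩, ?_, ?_⟩
  · funext u
    exact (mass_congr fun k => by rw [hx1]).trans (hmass u)
  · funext u
    exact (mass_congr fun l => by rw [hx2]).trans (h3 u)

lemma cellPoint_surjective (n : ℕ) : Function.Surjective (cellPoint n) := by
  intro y
  -- The point `y` itself serves as `a`. The resulting `t` need not sum to `1`, so it is rescaled by
  -- `c`, which normalization undoes.
  obtain ⟨t, s, h, ha⟩ := exists_isCoord (fun u => y u) (stdSimplex.zero_le y)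
  have hT : 0 < ∑ u, t u := by
    refine lt_of_le_of_ne (Finset.sum_nonneg fun u _ => h.nonneg u) fun h0 => ?_
    have h0' : ∀ u, t u = 0 := fun u =>
      (Finset.sum_eq_zero_iff_of_nonneg fun u _ => h.nonneg u).1 h0.symm u (Finset.mem_univ u)
    have hg : ∀ u, gap t u = 0 := fun u => le_antisymm
      (gap_le le_rfl fun v w _ _ => by rw [h0', h0', min_self]) (gap_nonneg h.nonneg u)
    have := stdSimplex.sum_eq_one y
    simp only [← ha, h0', hg, mul_zero, add_zero, Finset.sum_const_zero] at this
    exact zero_ne_one this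
  set c := (∑ u, t u)⁻¹ with hc
  have hc0 : 0 < c := inv_pos.2 hT
  obtain ⟨p, q, x, τ, σ, e1, e2⟩ := exists_cell (h.smul hc0) (by
    rw [← Finset.mul_sum, hc, inv_mul_cancel₀ hT.ne'])
  have hu : ∀ u, unnormalized x τ σ u = c * y u := fun u => by
    rw [unnormalized_eq, e1, e2, gap_smul hc0.le, ← ha]
    ring
  refine ⟨cell x τ σ, stdSimplex.ext (funext fun u => ?_)⟩
  change unnormalized x τ σ u / ∑ v, unnormalized x τ σ v = y u
  simp only [hu]
  rw [← Finset.mul_sum, stdSimplex.sum_eq_one y, mul_one, mul_div_cancel_left₀ _ hc0.ne']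

/-! ### The homeomorphism -/

/-- The comparison map. -/
def spacePoint (n : ℕ) : BarSpace (SimplexCategory.toCat.obj (SimplexCategory.mk n)) →
    stdSimplex ℝ (Fin (n + 1)) :=
  Quot.lift (cellPoint n) (cellPoint_rel n)

lemma continuous_spacePoint (n : ℕ) : Continuous (spacePoint n) :=
  continuous_quot_lift _ (continuous_cellPoint n)

lemma exists_barMk_isReduced {n : ℕ}
    (z : BarSpace (SimplexCategory.toCat.obj (SimplexCategory.mk n))) : ∃ (p q : ℕ)
    (x : BarSimplex (SimplexCategory.toCat.obj (SimplexCategory.mk n)) p q)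
    (τ : stdSimplex ℝ (Fin (p + 1))) (σ : stdSimplex ℝ (Fin (q + 1))),
    IsReduced x τ σ ∧ barMk x τ σ = z := by
  induction z using Quot.ind with
  | mk z =>
    obtain ⟨⟨p, q, x⟩, τ, σ⟩ := z
    exact exists_isReduced x τ σ

lemma spacePoint_bijective (n : ℕ) : Function.Bijective (spacePoint n) := by
  constructor
  · intro y z e
    obtain ⟨p, q, x, τ, σ, h, rfl⟩ := exists_barMk_isReduced y
    obtain ⟨p', q', x', τ', σ', h', rfl⟩ := exists_barMk_isReduced z
    exact congrArg (Quot.mk _) (h.cell_eq_of_barPoint_eq h' e)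
  · intro y
    obtain ⟨z, rfl⟩ := cellPoint_surjective n y
    exact ⟨Quot.mk _ z, rfl⟩

/-- A reduced representative has injective labels and vertex sets, which bounds `p` by the number of
objects and `q` by the number of their subsets. Finitely many products of simplices thus cover the
space. -/
instance compactSpace_barSpace (n : ℕ) :
    CompactSpace (BarSpace (SimplexCategory.toCat.obj (SimplexCategory.mk n))) := by
  have hfin : ∀ p q, Finite (BarSimplex (SimplexCategory.toCat.obj (SimplexCategory.mk n)) p q) :=
    fun p q => finite_string (isOrderLabel_idLabel n) p q
  let N := Fintype.card (Finset (Fin (n + 1)))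
  let I := Σ (p : Fin (n + 1)) (q : Fin N),
    BarSimplex (SimplexCategory.toCat.obj (SimplexCategory.mk n)) p q
  let f : (Σ i : I, stdSimplex ℝ (Fin (i.1 + 1)) × stdSimplex ℝ (Fin (i.2.1 + 1))) →
      BarSpace (SimplexCategory.toCat.obj (SimplexCategory.mk n)) :=
    fun z => barMk z.1.2.2 z.2.1 z.2.2
  have hf : Continuous f := by
    refine continuous_sigma fun i => continuous_quot_mk.comp ?_
    exact continuous_sigmaMk (σ := fun x : (Σ p q : ℕ,
      BarSimplex (SimplexCategory.toCat.obj (SimplexCategory.mk n)) p q) =>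
      stdSimplex ℝ (Fin (x.1 + 1)) × stdSimplex ℝ (Fin (x.2.1 + 1)))
      (i := ⟨i.1, i.2.1, i.2.2⟩)
  have hs : Function.Surjective f := by
    intro z
    obtain ⟨p, q, x, τ, σ, h, rfl⟩ := exists_barMk_isReduced z
    have hp := Fintype.card_le_of_injective _ h.labels.injective
    have hq := Fintype.card_le_of_injective _ h.vsets.injective
    rw [Fintype.card_fin] at hp hq
    rw [Fintype.card_fin] at hp
    exact ⟨⟨⟨⟨p, hp⟩, ⟨q, hq⟩, x⟩, τ, σ⟩, rfl⟩
  exact hs.compactSpace hf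

/-- The comparison map is a homeomorphism. -/
def spaceHomeo (n : ℕ) : BarSpace (SimplexCategory.toCat.obj (SimplexCategory.mk n)) ≃ₜ
    stdSimplex ℝ (Fin (n + 1)) :=
  (continuous_spacePoint n).homeoOfEquivCompactToT2
    (f := Equiv.ofBijective _ (spacePoint_bijective n))

/-! ### Naturality -/

/-- Injectivity transports `t` and `s` unchanged to the image of `θ` and gives zero elsewhere. Pairs
with an index outside the image contribute zero to the maximum, so gaps are preserved as well. -/
lemma cellPoint_cellMap {m n : ℕ} (θ : SimplexCategory.mk m ⟶ SimplexCategory.mk n)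
    (hθ : Function.Injective θ) (z : BarCells (SimplexCategory.toCat.obj (SimplexCategory.mk m))) :
    cellPoint n (cellMap (SimplexCategory.toCat.map θ) z) = stdSimplex.map θ (cellPoint m z) := by
  classical
  obtain ⟨⟨p, q, x⟩, τ, σ⟩ := z
  set x' : BarSimplex (SimplexCategory.toCat.obj (SimplexCategory.mk n)) p q :=
    ((bar q).map (SimplexCategory.toCat.map θ)).app (op (SimplexCategory.mk p)) x with hx'
  have hlt : ∀ {u v : Fin (m + 1)}, θ u < θ v ↔ u < v := fun {u v} =>
    (θ.toOrderHom.monotone.strictMono_of_injective hθ).lt_iff_lt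
  have hl : labels (idLabel n) x' = θ ∘ labels (idLabel m) x :=
    labels_map _ _ (toCat_map_idLabel θ) x
  have hv : ∀ l, vsets (idLabel n) x' l = (vsets (idLabel m) x l).image θ :=
    vsets_map _ _ (toCat_map_idLabel θ) x
  have ht : ∀ u, objMass x' τ (θ u) = objMass x τ u := fun u => by
    rw [objMass, hl]
    exact mass_congr fun k => hθ.eq_iff
  have ht0 : ∀ v, v ∉ Set.range θ → objMass x' τ v = 0 := fun v hv => by
    rw [objMass, hl]
    exact mass_eq_zero fun k hk => hv ⟨_, hk⟩
  have hs : ∀ u, passMass x' σ (θ u) = passMass x σ u := fun u => by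
    refine mass_congr fun l => ?_
    rw [hv]
    exact hθ.mem_finset_image
  have hs0 : ∀ v, v ∉ Set.range θ → passMass x' σ v = 0 := fun v hv' => by
    refine mass_eq_zero fun l hl => ?_
    rw [hv, Finset.mem_image] at hl
    obtain ⟨u, -, rfl⟩ := hl
    exact hv' ⟨u, rfl⟩
  have hg : ∀ u, gap (objMass x' τ) (θ u) = gap (objMass x τ) u := fun u => by
    refine le_antisymm (gap_le (gap_nonneg (objMass_nonneg x τ) u) fun v w hv hw => ?_)
      (gap_le (gap_nonneg (objMass_nonneg x' τ) _) fun v w hv hw => ?_)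
    · by_cases hv' : v ∈ Set.range θ
      · by_cases hw' : w ∈ Set.range θ
        · obtain ⟨v, rfl⟩ := hv'
          obtain ⟨w, rfl⟩ := hw'
          rw [ht, ht]
          exact min_le_gap _ (hlt.1 hv) (hlt.1 hw)
        · exact (min_le_right _ _).trans
            ((ht0 w hw').trans_le (gap_nonneg (objMass_nonneg x τ) u))
      · exact (min_le_left _ _).trans ((ht0 v hv').trans_le (gap_nonneg (objMass_nonneg x τ) u))
    · rw [← ht, ← ht]
      exact min_le_gap _ (hlt.2 hv) (hlt.2 hw)
  have ha : ∀ u, unnormalized x' τ σ (θ u) = unnormalized x τ σ u := fun u => by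
    rw [unnormalized_eq, unnormalized_eq, ht, hs, hg]
  have ha0 : ∀ v, v ∉ Set.range θ → unnormalized x' τ σ v = 0 := fun v hv => by
    rw [unnormalized_eq, ht0 v hv, hs0 v hv, zero_mul, add_zero]
  have hsum : ∑ v, unnormalized x' τ σ v = ∑ u, unnormalized x τ σ u :=
    (Fintype.sum_of_injective θ hθ _ _ ha0 fun u => (ha u).symm).symm
  refine stdSimplex.ext (funext fun v => ?_)
  rw [stdSimplex.map_coe, FunOnFinite.linearMap_apply_apply, Finset.sum_filter]
  change unnormalized x' τ σ v / ∑ v, unnormalized x' τ σ v =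
    ∑ u, if θ u = v then unnormalized x τ σ u / ∑ w, unnormalized x τ σ w else 0
  rw [hsum]
  by_cases hv' : v ∈ Set.range θ
  · obtain ⟨u, rfl⟩ := hv'
    simp only [hθ.eq_iff]
    rw [Finset.sum_ite_eq' Finset.univ u, if_pos (Finset.mem_univ u), ha]
  · rw [ha0 v hv', zero_div]
    exact (Finset.sum_eq_zero fun u _ => if_neg fun e => hv' ⟨u, e⟩).symm

/-- The homeomorphism as an isomorphism of topological spaces. -/
def barIso (X : SimplexCategory) :
    barRealization.obj (SimplexCategory.toCat.obj X) ≅ SimplexCategory.toTop₀.obj X :=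
  TopCat.isoOfHomeo (spaceHomeo X.len)

lemma barIso_naturality {X Y : SimplexCategory} (θ : X ⟶ Y)
    (hθ : tildeGen.multiplicativeClosure θ) :
    barRealization.map (SimplexCategory.toCat.map θ) ≫ (barIso Y).hom =
      (barIso X).hom ≫ SimplexCategory.toTop₀.map θ := by
  have gen : ∀ {X Y : SimplexCategory} (θ : X ⟶ Y), tildeGen θ →
      barRealization.map (SimplexCategory.toCat.map θ) ≫ (barIso Y).hom =
        (barIso X).hom ≫ SimplexCategory.toTop₀.map θ := by
    intro X Y θ h
    cases h with
    | inj f hf =>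
      ext z : 2
      induction z using Quot.ind with
      | mk z => exact cellPoint_cellMap θ hf z
    | collapse =>
      ext z : 2
      -- The collapse needs no computation because `|Δ^0|` is a point.
      exact Subsingleton.elim (α := stdSimplex ℝ (Fin 1)) _ _
  induction hθ with
  | of f hf => exact gen f hf
  | id X =>
    exact (congrArg (· ≫ (barIso X).hom)
      ((SimplexCategory.toCat ⋙ barRealization).map_id X)).trans ((Category.id_comp _).trans
      ((Category.comp_id _).symm.trans (congrArg ((barIso X).hom ≫ ·)
        (CategoryTheory.Functor.map_id (SimplexCategory.toTop₀ : SimplexCategory ⥤ TopCat)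
          X).symm)))
  | comp_of f g _ hg ih =>
    exact (congrArg (· ≫ (barIso _).hom)
      ((SimplexCategory.toCat ⋙ barRealization).map_comp f g)).trans ((Category.assoc _ _ _).trans
      ((congrArg (barRealization.map (SimplexCategory.toCat.map f) ≫ ·) (gen g hg)).trans
      ((Category.assoc _ _ _).symm.trans ((congrArg (· ≫ SimplexCategory.toTop₀.map g) ih).trans
      ((Category.assoc _ _ _).trans (congrArg ((barIso _).hom ≫ ·) (Functor.map_comp
        (SimplexCategory.toTop₀ : SimplexCategory ⥤ TopCat) f g).symm))))))

end FreeBar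

end

theorem mainTheorem9 :
    ∃ h : FreeBar.tildeIncl ⋙ SimplexCategory.toCat ⋙ FreeBar.barRealization ≅
        FreeBar.tildeIncl ⋙ SimplexCategory.toTop₀,
      ∀ (n p q : ℕ) (x : FreeBar.BarSimplex (SimplexCategory.toCat.obj (SimplexCategory.mk n)) p q)
        (τ : stdSimplex ℝ (Fin (p + 1))) (σ : stdSimplex ℝ (Fin (q + 1))) (u : Fin (n + 1)),
        FreeBar.coord (h.hom.app ⟨SimplexCategory.mk n⟩ (Quot.mk _ (FreeBar.cell x τ σ))) u =
          FreeBar.unnormalized x τ σ u / ∑ v, FreeBar.unnormalized x τ σ v :=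
  ⟨NatIso.ofComponents (fun X => FreeBar.barIso X.obj)
    -- The formula is definitional, since the homeomorphism is the descent of `cellPoint` to the
    -- quotient.
    fun f => FreeBar.barIso_naturality f.hom f.property, fun _ _ _ _ _ _ _ => rfl⟩
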